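/- Let $A$ be an involutive Banach algebra (a complex Banach algebra, not necessarily unital, with an isometric conjugate-linear anti-multiplicative involution $a\mapsto a^*$), and let $\pi:A\to B(\mathcal H)$ be a $*$-representation on a Hilbert space $\mathcal H$ (possibly degenerate; $\pi$ is then automatically contractive). Definitions. Inner products are linear in the first variable. For $\xi,\eta\in\mathcal H$ let $\xi*_\pi\eta\in A^*$, $(\xi*_\pi\eta)(a)=\langle\pi(a)\xi\mid\eta\rangle$. Let $\overline{\mathcal H}$ be the conjugate Hilbert space, whose vectors are written $\dot\eta$ for $\eta\in\mathcal H$, with the contractive right $A$-module action $\dot\eta\cdot a=(\pi(a)^*\eta)^{\cdot}$. Let $p:\overline{\mathcal H}^*\otimes^\gamma\overline{\mathcal H}\to A^*$ be the bounded linear map on the Banach space projective tensor product determined by $\langle p(f\otimes x),a\rangle=\langle f,x\cdot a\rangle$; under the identification $\overline{\mathcal H}^*\cong\mathcal H$, $\langle\xi,\dot\eta\rangle=\langle\xi\mid\eta\rangle$, one has $p(\xi\otimes\dot\eta)=\xi*_\pi\eta$. The Fourier space $\mathcal F_\pi(A^*)$ is the range of $p$, with the quotient norm $\|\phi\|_\pi=\inf\{\|t\|_\gamma: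 p(t)=\phi\}$. For $\phi\in A^*$ and $a\in A$ let $\langle\phi\cdot a,b\rangle=\langle\phi,ab\rangle$ $(b\in A)$. A linear subspace $\mathcal S\subseteq A^*$ with a complete norm $\|\cdot\|_{\mathcal S}$ is a left introverted homogeneous subspace if (i) $\|\phi\|_{A^*}\le\|\phi\|_{\mathcal S}$ for $\phi\in\mathcal S$; (ii) $\phi\cdot a\in\mathcal S$ and $\|\phi\cdot a\|_{\mathcal S}\le\|\phi\|_{\mathcal S}\|a\|$ for $\phi\in\mathcal S$, $a\in A$; (iii) for $\mu\in\mathcal S^*$ and $\phi\in\mathcal S$ the functional $\mu\,\square\,\phi$ on $A$, $\langle\mu\,\square\,\phi,a\rangle=\langle\mu,\phi\cdot a\rangle$, lies in $\mathcal S$ and $\|\mu\,\square\,\phi\|_{\mathcal S}\le\|\mu\|\|\phi\|_{\mathcal S}$. In that case $\mathcal S^*$ carries the product $\langle\mu\,\square\,\nu,\phi\rangle=\langle\mu,\nu\,\square\,\phi\rangle$. The weak* topology of $B(\mathcal H)$ is the $\sigma$-weak topology, generated by the functionals $T\mapsto\sum_n\langle T\xi_n\mid\eta_n\rangle$ with $\sum_n\|\xi_n\|\|\eta_n\|<\infty$;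 the weak* topology of $\mathcal F_\pi(A^*)^*$ is that of the dual of $(\mathcal F_\pi(A^*),\|\cdot\|_\pi)$. Then: (a) If $(\xi_n),(\eta_n)$ are sequences in $\mathcal H$ with $\sum\|\xi_n\|\|\eta_n\|<\infty$, then the series $\sum\xi_n*_\pi\eta_n$ converges in $\sigma(A^*,A)$ to an element of $\mathcal F_\pi(A^*)$, and it converges to that element in $\|\cdot\|_\pi$. Conversely, every $\phi\in\mathcal F_\pi(A^*)$ is such a sum, and $$\|\phi\|_\pi=\inf\Big\{\sum\|\xi_n\|\|\eta_n\| : \phi=\sum\xi_n*_\pi\eta_n,\ \sum\|\xi_n\|\|\eta_n\|<\infty\Big\}.$$ (b) $(\mathcal F_\pi(A^*),\|\cdot\|_\pi)$ is a left introverted homogeneous subspace of $A^*$, closed under $\phi\mapsto\phi^*$, where $\phi^*(a)=\overline{\phi(a^*)}$. Moreover $(\xi*_\pi\eta)^*=\eta*_\pi\xi$, and $\phi\mapsto\phi^*$ is isometric for $\|\cdot\|_{A^*}$ on $A^*$ and for $\|\cdot\|_\pi$ on $\mathcal F_\pi(A^*)$. (c) With the involution $\mu^*(\phi)=\overline{\mu(\phi^*)}$,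 $(\mathcal F_\pi(A^*)^*,\square)$ is a W*-algebra. The weak* closure $VN_\pi=\overline{\pi(A)}^{w^*}$ is the smallest weak*-closed $*$-subalgebra of $B(\mathcal H)$ containing $\pi(A)$, and the formula $\langle\breve\pi(\mu)\xi\mid\eta\rangle=\langle\mu,\xi*_\pi\eta\rangle$ defines an isometric $*$-isomorphism $\breve\pi$ of $\mathcal F_\pi(A^*)^*$ onto $VN_\pi$ that is a homeomorphism for the weak* topologies. Moreover $\breve\pi\circ\eta_\pi=\pi$, where $\eta_\pi:A\to\mathcal F_\pi(A^*)^*$, $\langle\eta_\pi(a),\phi\rangle=\phi(a)$. (d) There is an isometric $*$-isomorphism $T\mapsto\mu_T$ of $VN_\pi$ onto $\mathcal F_\pi(A^*)^*$, a homeomorphism for the weak* topologies, such that $\langle\mu_T,\sum\xi_n*_\pi\eta_n\rangle=\sum\langle T\xi_n\mid\eta_n\rangle$ whenever $\sum\|\xi_n\|\|\eta_n\|<\infty$. -/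

import Mathlib

open scoped TensorProduct InnerProductSpace ComplexConjugate

noncomputable section

namespace FourierRep

universe u v

/-! ### The Banach space projective tensor product -/

section Projective

variable (E F : Type*) [NormedAddCommGroup E] [NormedSpace ℂ E]
  [NormedAddCommGroup F] [NormedSpace ℂ F]

/-- The algebraic tensor product `E ⊗ F`, to be equipped with the projective norm. -/
def AlgTensor : Type _ := E ⊗[ℂ] F

instance : AddCommGroup (AlgTensor E F) := inferInstanceAs (AddCommGroup (E ⊗[ℂ] F))

instance : Module ℂ (AlgTensor E F) := inferInstanceAs (Module ℂ (E ⊗[ℂ] F))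

variable {E F}

/-- The elementary tensor `x ⊗ y`. -/
def tmul (x : E) (y : F) : AlgTensor E F := (x ⊗ₜ[ℂ] y : E ⊗[ℂ] F)

/-- The element `∑ x ⊗ y`, summed over a finite list of pairs `(x, y)`. -/
def listTensor (l : List (E × F)) : AlgTensor E F :=
  (l.map fun z => tmul z.1 z.2).sum

/-- The number `∑ ‖x‖ ‖y‖`, summed over a finite list of pairs `(x, y)`. -/
def listCost (l : List (E × F)) : ℝ := (l.map fun z => ‖z.1‖ * ‖z.2‖).sum

/-- The projective norm: the infimum of `∑ ‖x‖ ‖y‖` over all finite representations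
`t = ∑ x ⊗ y`. -/
def projNorm (t : AlgTensor E F) : ℝ :=
  sInf {r | ∃ l : List (E × F), listTensor l = t ∧ r = listCost l}

set_option linter.unusedSectionVars false in
lemma listCost_nonneg (l : List (E × F)) : 0 ≤ listCost l := by
  refine List.sum_nonneg fun r hr => ?_
  obtain ⟨z, -, rfl⟩ := List.mem_map.1 hr
  positivity

lemma exists_listTensor (t : AlgTensor E F) : ∃ l : List (E × F), listTensor l = t := by
  induction (show E ⊗[ℂ] F from t) using TensorProduct.induction_on with
  | zero => exact ⟨[], rfl⟩
  | tmul x y => exact ⟨[(x, y)], by simp only [listTensor, List.map_cons, List.map_nil,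
      List.sum_cons, List.sum_nil, add_zero]; rfl⟩
  | add s t hs ht =>
    obtain ⟨l, rfl⟩ := hs
    obtain ⟨m, rfl⟩ := ht
    exact ⟨l ++ m, by simp only [listTensor, List.map_append, List.sum_append]; rfl⟩

lemma projNorm_le (l : List (E × F)) : projNorm (listTensor l) ≤ listCost l :=
  csInf_le ⟨0, by rintro _ ⟨l, -, rfl⟩; exact listCost_nonneg l⟩ ⟨l, rfl, rfl⟩

lemma le_projNorm {t : AlgTensor E F} {c : ℝ} (h : ∀ l, listTensor l = t → c ≤ listCost l) :
    c ≤ projNorm t := by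
  obtain ⟨l, hl⟩ := exists_listTensor t
  refine le_csInf ⟨_, l, hl, rfl⟩ ?_
  rintro _ ⟨l, hl, rfl⟩
  exact h l hl

lemma projNorm_nonneg (t : AlgTensor E F) : 0 ≤ projNorm t :=
  le_projNorm fun l _ => listCost_nonneg l

lemma projNorm_zero : projNorm (0 : AlgTensor E F) = 0 :=
  le_antisymm (projNorm_le ([] : List (E × F))) (projNorm_nonneg _)

lemma projNorm_add_le (s t : AlgTensor E F) : projNorm (s + t) ≤ projNorm s + projNorm t := by
  rw [← sub_le_iff_le_add]
  refine le_projNorm fun l hl => ?_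
  rw [sub_le_iff_le_add, ← sub_le_iff_le_add']
  refine le_projNorm fun m hm => ?_
  rw [sub_le_iff_le_add']
  have h := projNorm_le (l ++ m)
  have h1 : listTensor (l ++ m) = s + t := by
    rw [← hl, ← hm]; simp [listTensor]
  have h2 : listCost (l ++ m) = listCost l + listCost m := by simp [listCost]
  rwa [h1, h2] at h

lemma projNorm_smul_le (c : ℂ) (t : AlgTensor E F) : projNorm (c • t) ≤ ‖c‖ * projNorm t := by
  obtain rfl | hc := eq_or_ne c 0
  · simp [projNorm_zero]
  rw [mul_comm, ← div_le_iff₀ (norm_pos_iff.2 hc)]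
  refine le_projNorm fun l hl => ?_
  rw [div_le_iff₀ (norm_pos_iff.2 hc)]
  have h := projNorm_le (l.map fun z => (c • z.1, z.2))
  have h1 : listTensor (l.map fun z => (c • z.1, z.2)) = c • t := by
    rw [← hl]
    simp only [listTensor, List.smul_sum, List.map_map]
    rfl
  have h2 : listCost (l.map fun z => (c • z.1, z.2)) = listCost l * ‖c‖ := by
    simp only [listCost, List.map_map, ← List.sum_map_mul_right]
    congr 2
    funext z
    simp only [Function.comp_apply, norm_smul]
    ring
  rwa [h1, h2] at h

instance : SeminormedAddCommGroup (AlgTensor E F) :=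
  AddGroupSeminorm.toSeminormedAddCommGroup
    (Seminorm.ofSMulLE (𝕜 := ℂ) (E := AlgTensor E F) projNorm projNorm_zero projNorm_add_le
      projNorm_smul_le).toAddGroupSeminorm

instance : NormedSpace ℂ (AlgTensor E F) := ⟨projNorm_smul_le⟩

variable (E F) in
/-- The Banach space projective tensor product: the completion of `E ⊗ F` for the projective
norm. -/
abbrev ProjTensor : Type _ := UniformSpace.Completion (AlgTensor E F)

variable {G : Type*} [NormedAddCommGroup G] [NormedSpace ℂ G]

/-- The linearization of a bounded bilinear map on the algebraic tensor product. -/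
def algLift (B : E →L[ℂ] F →L[ℂ] G) : AlgTensor E F →ₗ[ℂ] G :=
  (TensorProduct.lift (B.toLinearMap₁₂) : E ⊗[ℂ] F →ₗ[ℂ] G)

lemma algLift_tmul (B : E →L[ℂ] F →L[ℂ] G) (x : E) (y : F) : algLift B (tmul x y) = B x y :=
  TensorProduct.lift.tmul x y

lemma norm_algLift_le (B : E →L[ℂ] F →L[ℂ] G) (t : AlgTensor E F) :
    ‖algLift B t‖ ≤ ‖B‖ * ‖t‖ := by
  change _ ≤ ‖B‖ * projNorm t
  have key : ∀ l : List (E × F), ‖algLift B (listTensor l)‖ ≤ ‖B‖ * listCost l := by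
    intro l
    induction l with
    | nil => simp [listTensor, listCost]
    | cons z l ih =>
      have h1 : listTensor (z :: l) = tmul z.1 z.2 + listTensor l := by
        simp [listTensor]
      have h2 : listCost (z :: l) = ‖z.1‖ * ‖z.2‖ + listCost l := by simp [listCost]
      rw [h1, h2, map_add, algLift_tmul, mul_add, ← mul_assoc]
      exact (norm_add_le _ _).trans (add_le_add (B.le_opNorm₂ _ _) ih)
  obtain hB | hB := (norm_nonneg B).eq_or_lt
  · obtain ⟨l, rfl⟩ := exists_listTensor t
    simpa [← hB] using key l
  rw [mul_comm, ← div_le_iff₀ hB]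
  refine le_projNorm fun l hl => ?_
  rw [div_le_iff₀ hB, mul_comm, ← hl]
  exact key l

/-- The linearization of a bounded bilinear map on the projective tensor product. -/
def projLift [CompleteSpace G] (B : E →L[ℂ] F →L[ℂ] G) : ProjTensor E F →L[ℂ] G :=
  ((algLift B).mkContinuous ‖B‖ (norm_algLift_le B)).extend UniformSpace.Completion.toComplL

lemma projLift_tmul [CompleteSpace G] (B : E →L[ℂ] F →L[ℂ] G) (x : E) (y : F) :
    projLift B (tmul x y : AlgTensor E F) = B x y := by
  have h := ContinuousLinearMap.extend_eq ((algLift B).mkContinuous ‖B‖ (norm_algLift_le B))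
    (e := UniformSpace.Completion.toComplL) UniformSpace.Completion.denseRange_coe
    (UniformSpace.Completion.isUniformInducing_coe _) (tmul x y)
  exact h.trans (algLift_tmul B x y)

end Projective

/-! ### Introverted homogeneous subspaces of the dual of a Banach algebra -/

section Homogeneous

variable {A : Type u} [NonUnitalNormedRing A] [NormedSpace ℂ A] [IsScalarTower ℂ A A]
  [SMulCommClass ℂ A A]

/-- The right module action on the dual: `⟨φ · a, b⟩ = ⟨φ, a b⟩`. -/
def dualAct (φ : StrongDual ℂ A) (a : A) : StrongDual ℂ A := φ ∘L ContinuousLinearMap.mul ℂ A a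

variable {S : Type v} [NormedAddCommGroup S] [NormedSpace ℂ S]

/-- `S` is a linear space with a norm of its own, identified with a linear subspace of the dual of
`A` through the injective linear map `ι`. It is left homogeneous if its norm is complete, the
embedding is contractive, and `S` is a right `A`-submodule of the dual on which `A` acts
contractively for the norm of `S`. -/
structure IsLeftHomogeneous (ι : S →ₗ[ℂ] StrongDual ℂ A) : Prop where
  injective : Function.Injective ι
  complete : CompleteSpace S
  norm_le : ∀ φ : S, ‖ι φ‖ ≤ ‖φ‖
  exists_act : ∀ (φ : S) (a : A), ∃ ψ : S, ι ψ = dualAct (ι φ) a ∧ ‖ψ‖ ≤ ‖φ‖ * ‖a‖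

namespace IsLeftHomogeneous

variable {ι : S →ₗ[ℂ] StrongDual ℂ A}

/-- The element `φ · a` of `S`. -/
def act (h : IsLeftHomogeneous ι) (φ : S) (a : A) : S := (h.exists_act φ a).choose

lemma ι_act (h : IsLeftHomogeneous ι) (φ : S) (a : A) : ι (h.act φ a) = dualAct (ι φ) a :=
  (h.exists_act φ a).choose_spec.1

lemma norm_act_le (h : IsLeftHomogeneous ι) (φ : S) (a : A) : ‖h.act φ a‖ ≤ ‖φ‖ * ‖a‖ :=
  (h.exists_act φ a).choose_spec.2

/-- The functional `μ □ φ` on `A`, for `μ` in the dual of `S` and `φ` in `S`: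
`⟨μ □ φ, a⟩ = ⟨μ, φ · a⟩`. -/
def square (h : IsLeftHomogeneous ι) (μ : StrongDual ℂ S) (φ : S) : StrongDual ℂ A :=
  LinearMap.mkContinuous
    { toFun := fun a => μ (h.act φ a)
      map_add' := fun a b => by
        rw [← map_add]
        congr 1
        apply h.injective
        rw [map_add, h.ι_act, h.ι_act, h.ι_act]
        ext x
        simp [dualAct]
      map_smul' := fun c a => by
        rw [RingHom.id_apply, ← map_smul]
        congr 1
        apply h.injective
        rw [map_smul, h.ι_act, h.ι_act]
        ext x
        simp [dualAct] }
    (‖μ‖ * ‖φ‖) fun a => by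
      refine (μ.le_opNorm _).trans ?_
      rw [mul_assoc]
      exact mul_le_mul_of_nonneg_left (h.norm_act_le φ a) (norm_nonneg _)

/-- The canonical map `η` of `A` into the dual of `S`: `⟨η a, φ⟩ = ⟨φ, a⟩`. -/
def canonicalMap (h : IsLeftHomogeneous ι) (a : A) : StrongDual ℂ S :=
  LinearMap.mkContinuous
    { toFun := fun φ => ι φ a
      map_add' := fun φ ψ => by simp
      map_smul' := fun c φ => by simp }
    ‖a‖ fun φ => by
      refine ((ι φ).le_opNorm a).trans ?_
      rw [mul_comm]
      exact mul_le_mul_of_nonneg_left (h.norm_le φ) (norm_nonneg _)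

end IsLeftHomogeneous

/-- A left homogeneous subspace `S` is left introverted if every `μ □ φ` lies in `S` and
`(μ, φ) ↦ μ □ φ` is contractive for the norm of `S` and its dual norm. -/
structure IsLeftIntroverted (ι : S →ₗ[ℂ] StrongDual ℂ A) : Prop extends
    IsLeftHomogeneous ι where
  exists_square : ∀ (μ : StrongDual ℂ S) (φ : S),
    ∃ ψ : S, ι ψ = toIsLeftHomogeneous.square μ φ ∧ ‖ψ‖ ≤ ‖μ‖ * ‖φ‖

namespace IsLeftIntroverted

variable {ι : S →ₗ[ℂ] StrongDual ℂ A}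

/-- The element `μ □ φ` of `S`. -/
def squareIn (h : IsLeftIntroverted ι) (μ : StrongDual ℂ S) (φ : S) : S :=
  (h.exists_square μ φ).choose

lemma ι_squareIn (h : IsLeftIntroverted ι) (μ : StrongDual ℂ S) (φ : S) :
    ι (h.squareIn μ φ) = h.toIsLeftHomogeneous.square μ φ :=
  (h.exists_square μ φ).choose_spec.1

lemma norm_squareIn_le (h : IsLeftIntroverted ι) (μ : StrongDual ℂ S) (φ : S) :
    ‖h.squareIn μ φ‖ ≤ ‖μ‖ * ‖φ‖ :=
  (h.exists_square μ φ).choose_spec.2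

/-- The first Arens product on the dual of `S`: `⟨μ □ ν, φ⟩ = ⟨μ, ν □ φ⟩`. -/
def arensMul (h : IsLeftIntroverted ι) (μ ν : StrongDual ℂ S) : StrongDual ℂ S :=
  LinearMap.mkContinuous
    { toFun := fun φ => μ (h.squareIn ν φ)
      map_add' := fun φ ψ => by
        rw [← map_add]
        congr 1
        apply h.injective
        rw [map_add, h.ι_squareIn, h.ι_squareIn, h.ι_squareIn]
        ext a
        change ν _ = ν _ + ν _
        rw [← map_add]
        congr 1
        apply h.injective
        rw [map_add, h.ι_act, h.ι_act, h.ι_act]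
        ext x
        simp [dualAct]
      map_smul' := fun c φ => by
        rw [RingHom.id_apply, ← map_smul]
        congr 1
        apply h.injective
        rw [map_smul, h.ι_squareIn, h.ι_squareIn]
        ext a
        change ν _ = c • ν _
        rw [← map_smul]
        congr 1
        apply h.injective
        rw [map_smul, h.ι_act, h.ι_act]
        ext x
        simp [dualAct] }
    (‖μ‖ * ‖ν‖) fun φ => by
      refine (μ.le_opNorm _).trans ?_
      rw [mul_assoc]
      exact mul_le_mul_of_nonneg_left (h.norm_squareIn_le ν φ) (norm_nonneg _)

end IsLeftIntroverted

end Homogeneous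

/-! ### The Fourier space of a contractive right module -/

section Fourier

/-- A contractive right Banach `A`-module action `(x, a) ↦ x · a` on `X`. -/
structure RightAction (A X : Type*) [NonUnitalNormedRing A] [NormedSpace ℂ A]
    [NormedAddCommGroup X] [NormedSpace ℂ X] where
  /-- the action as a bounded bilinear map -/
  act : X →L[ℂ] A →L[ℂ] X
  act_mul : ∀ (x : X) (a b : A), act x (a * b) = act (act x a) b
  norm_act_le : ∀ (x : X) (a : A), ‖act x a‖ ≤ ‖x‖ * ‖a‖

variable {A : Type u} [NonUnitalNormedRing A] [NormedSpace ℂ A]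
  {X : Type v} [NormedAddCommGroup X] [NormedSpace ℂ X]

namespace RightAction

/-- The Arens transpose `(x*, x) ↦ x* · x`, where `⟨x* · x, a⟩ = ⟨x*, x · a⟩`. -/
def transpose (q : RightAction A X) : StrongDual ℂ X →L[ℂ] X →L[ℂ] StrongDual ℂ A :=
  (ContinuousLinearMap.compL ℂ X (A →L[ℂ] X) (StrongDual ℂ A)).flip q.act ∘L
    ContinuousLinearMap.compL ℂ A X ℂ

lemma transpose_apply (q : RightAction A X) (f : StrongDual ℂ X) (x : X) (a : A) :
    q.transpose f x a = f (q.act x a) := rfl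

/-- The linearization `p` of the Arens transpose on the projective tensor product of the dual
of `X` with `X`. -/
def proj (q : RightAction A X) : ProjTensor (StrongDual ℂ X) X →L[ℂ] StrongDual ℂ A :=
  projLift q.transpose

/-- The Fourier space of `q` as a linear subspace of the dual of `A`: the range of `p`. -/
def fourierSubmodule (q : RightAction A X) : Submodule ℂ (StrongDual ℂ A) :=
  LinearMap.range q.proj.toLinearMap

/-- The Fourier space of `q`, to be equipped with the quotient norm of the projective tensor
product by the kernel of `p` (and not with the norm of the dual of `A`). -/
def FourierSpace (q : RightAction A X) : Type u := q.fourierSubmodule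

instance (q : RightAction A X) : AddCommGroup q.FourierSpace :=
  inferInstanceAs (AddCommGroup q.fourierSubmodule)

instance (q : RightAction A X) : Module ℂ q.FourierSpace :=
  inferInstanceAs (Module ℂ q.fourierSubmodule)

/-- The inclusion of the Fourier space in the dual of `A`. -/
def incl (q : RightAction A X) : q.FourierSpace →ₗ[ℂ] StrongDual ℂ A := q.fourierSubmodule.subtype

/-- A functional on `A` in the range of `p`, as an element of the Fourier space. -/
def mkFourier (q : RightAction A X) (φ : StrongDual ℂ A) (hφ : φ ∈ q.fourierSubmodule) :
    q.FourierSpace := ⟨φ, hφ⟩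

instance (q : RightAction A X) :
    IsClosed (LinearMap.ker q.proj.toLinearMap :
      Set (ProjTensor (StrongDual ℂ X) X)) :=
  q.proj.isClosed_ker

/-- The linear isomorphism between the quotient by the kernel of `p` and the Fourier space. -/
def quotEquiv (q : RightAction A X) :
    (ProjTensor (StrongDual ℂ X) X ⧸ LinearMap.ker q.proj.toLinearMap) ≃ₗ[ℂ] q.FourierSpace :=
  q.proj.toLinearMap.quotKerEquivRange

instance (q : RightAction A X) : NormedAddCommGroup q.FourierSpace :=
  NormedAddCommGroup.induced q.FourierSpace
    (ProjTensor (StrongDual ℂ X) X ⧸ LinearMap.ker q.proj.toLinearMap)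
    q.quotEquiv.symm q.quotEquiv.symm.injective

instance (q : RightAction A X) : NormedSpace ℂ q.FourierSpace :=
  NormedSpace.induced ℂ q.FourierSpace
    (ProjTensor (StrongDual ℂ X) X ⧸ LinearMap.ker q.proj.toLinearMap) q.quotEquiv.symm

end RightAction

end Fourier

/-! ### The conjugate Hilbert space -/

section Conjugate

variable (H : Type v) [NormedAddCommGroup H] [InnerProductSpace ℂ H]

/-- The conjugate space of `H`: the same vectors and norm, with `c • x` meaning `conj c • x`. -/
def Conj (H : Type v) : Type v := H

variable {H} in
/-- A vector of `H`, viewed in the conjugate space. -/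
def dot (x : H) : Conj H := x

variable {H} in
/-- A vector of the conjugate space, viewed in `H`. -/
def undot (x : Conj H) : H := x

instance : NormedAddCommGroup (Conj H) := inferInstanceAs (NormedAddCommGroup H)

instance : Module ℂ (Conj H) := Module.compHom H (starRingEnd ℂ)

variable {H} in
lemma undot_smul (c : ℂ) (x : Conj H) : undot (c • x) = conj c • undot x := rfl

instance : NormedSpace ℂ (Conj H) where
  norm_smul_le c x := by
    have h := norm_smul (conj c) (undot x)
    rw [RCLike.norm_conj] at h
    exact h.le

end Conjugate

/-! ### The Fourier space of a `*`-representation -/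

section Representation

variable {A : Type u} [NonUnitalNormedRing A] [NormedSpace ℂ A] [IsScalarTower ℂ A A]
  [SMulCommClass ℂ A A] [StarRing A] [NormedStarGroup A] [CompleteSpace A]
  {H : Type v} [NormedAddCommGroup H] [InnerProductSpace ℂ H] [CompleteSpace H]

/-- A `*`-representation of an involutive Banach algebra is automatically contractive. -/
lemma norm_rep_le (π : A →⋆ₙₐ[ℂ] (H →L[ℂ] H)) (a : A) : ‖π a‖ ≤ ‖a‖ := by
  have key : ∀ b : A, IsSelfAdjoint b → ‖π b‖ ≤ ‖b‖ := by
    intro b hb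
    have h1 : spectralRadius ℂ (π b) = ‖π b‖₊ := (hb.map π).spectralRadius_eq_nnnorm
    have h2 : spectralRadius ℂ (π b) ≤ ‖b‖₊ := by
      refine iSup₂_le fun z hz => ?_
      have hz' : z ∈ quasispectrum ℂ b :=
        NonUnitalAlgHom.quasispectrum_apply_subset π b (spectrum_subset_quasispectrum ℂ _ hz)
      rw [Unitization.quasispectrum_eq_spectrum_inr' ℂ ℂ,
        ← AlgEquiv.spectrum_eq (WithLp.unitizationAlgEquiv ℂ).symm (b : Unitization ℂ A)] at hz'
      have : NormOneClass (WithLp 1 (Unitization ℂ A)) := ⟨by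
        rw [WithLp.unitization_norm_def]
        change ‖(1 : Unitization ℂ A).fst‖ + ‖(1 : Unitization ℂ A).snd‖ = 1
        simp⟩
      have h3 := spectrum.norm_le_norm_of_mem hz'
      have h4 : ‖(WithLp.unitizationAlgEquiv ℂ).symm (b : Unitization ℂ A)‖ = ‖b‖ :=
        WithLp.unitization_norm_inr b
      rw [h4] at h3
      exact_mod_cast h3
    rw [h1] at h2
    exact_mod_cast h2
  have h := key (star a * a) (IsSelfAdjoint.star_mul_self a)
  rw [map_mul, map_star, CStarRing.norm_star_mul_self] at h
  have h' : ‖star a * a‖ ≤ ‖a‖ * ‖a‖ := by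
    simpa [norm_star] using norm_mul_le (star a) a
  exact abs_le_of_sq_le_sq' (by nlinarith) (norm_nonneg a) |>.2

/-- The right module action of `A` on the conjugate of `H`: `ξ · a = π(a)* ξ`. -/
def moduleAction (π : A →⋆ₙₐ[ℂ] (H →L[ℂ] H)) : RightAction A (Conj H) where
  act := LinearMap.mkContinuous₂
    (LinearMap.mk₂ ℂ (fun (x : Conj H) (a : A) => dot (ContinuousLinearMap.adjoint (π a) (undot x)))
      (fun x y a => map_add (ContinuousLinearMap.adjoint (π a)) (undot x) (undot y))
      (fun c x a => by
        rw [undot_smul]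
        exact map_smul (ContinuousLinearMap.adjoint (π a)) (conj c) (undot x))
      (fun x a b => by
        rw [map_add, map_add]
        rfl)
      (fun c x a => by
        rw [map_smul, map_smulₛₗ]
        rfl))
    1 (fun x a => by
      rw [one_mul, mul_comm]
      refine (ContinuousLinearMap.le_opNorm (ContinuousLinearMap.adjoint (π a)) (undot x)).trans ?_
      rw [LinearIsometryEquiv.norm_map]
      exact mul_le_mul_of_nonneg_right (norm_rep_le π a) (norm_nonneg _))
  act_mul x a b := by
    change dot (ContinuousLinearMap.adjoint (π (a * b)) (undot x)) =
      dot (ContinuousLinearMap.adjoint (π b) (ContinuousLinearMap.adjoint (π a) (undot x)))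
    rw [map_mul, ContinuousLinearMap.mul_def, ContinuousLinearMap.adjoint_comp]
    rfl
  norm_act_le x a := by
    rw [mul_comm]
    refine (ContinuousLinearMap.le_opNorm (ContinuousLinearMap.adjoint (π a)) (undot x)).trans ?_
    rw [LinearIsometryEquiv.norm_map]
    exact mul_le_mul_of_nonneg_right (norm_rep_le π a) (norm_nonneg _)

/-- The Fourier space of `π`, with its Fourier norm. -/
abbrev FourierSpaceOf (π : A →⋆ₙₐ[ℂ] (H →L[ℂ] H)) : Type u := (moduleAction π).FourierSpace

/-- The inclusion of the Fourier space of `π` in the dual of `A`. -/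
abbrev fourierIncl (π : A →⋆ₙₐ[ℂ] (H →L[ℂ] H)) : FourierSpaceOf π →ₗ[ℂ] StrongDual ℂ A :=
  (moduleAction π).incl

/-- The coefficient functional `ξ *_π η`, that is, `a ↦ ⟨π(a) ξ | η⟩` with the inner product
linear in the first variable. (The inner product `⟪η, ζ⟫_ℂ` is linear in `ζ`.) -/
def coeff (π : A →⋆ₙₐ[ℂ] (H →L[ℂ] H)) (ξ η : H) : StrongDual ℂ A :=
  LinearMap.mkContinuous
    { toFun := fun a => ⟪η, π a ξ⟫_ℂ
      map_add' := fun a b => by simp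
      map_smul' := fun c a => by simp }
    (‖η‖ * ‖ξ‖) fun a => by
      refine (norm_inner_le_norm η (π a ξ)).trans ?_
      have h := ((π a).le_opNorm ξ).trans
        (mul_le_mul_of_nonneg_right (norm_rep_le π a) (norm_nonneg ξ))
      nlinarith [mul_le_mul_of_nonneg_left h (norm_nonneg η)]

/-- A vector `ξ` of `H` as the functional `η ↦ ⟨ξ | η⟩` on the conjugate space. -/
def conjFunctional (ξ : H) : StrongDual ℂ (Conj H) :=
  LinearMap.mkContinuous
    { toFun := fun η => ⟪undot η, ξ⟫_ℂ
      map_add' := fun x y => inner_add_left (undot x) (undot y) ξ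
      map_smul' := fun c x => by
        rw [undot_smul, inner_smul_left]
        simp }
    ‖ξ‖ fun η => by
      rw [mul_comm]
      exact norm_inner_le_norm (undot η) ξ

lemma coeff_mem (π : A →⋆ₙₐ[ℂ] (H →L[ℂ] H)) (ξ η : H) :
    coeff π ξ η ∈ (moduleAction π).fourierSubmodule := by
  refine ⟨(tmul (conjFunctional ξ) (dot η) : AlgTensor _ _), ?_⟩
  refine (projLift_tmul _ _ _).trans ?_
  ext a
  exact ContinuousLinearMap.adjoint_inner_left (π a) ξ η

/-- The coefficient functional `ξ *_π η` as an element of the Fourier space of `π`. -/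
def coeffIn (π : A →⋆ₙₐ[ℂ] (H →L[ℂ] H)) (ξ η : H) : FourierSpaceOf π :=
  (moduleAction π).mkFourier (coeff π ξ η) (coeff_mem π ξ η)

/-- The functional `φ*`, where `φ*(a) = conj (φ (a*))`. -/
def starFunctional [StarModule ℂ A] (φ : StrongDual ℂ A) : StrongDual ℂ A :=
  LinearMap.mkContinuous
    { toFun := fun a => conj (φ (star a))
      map_add' := fun a b => by simp
      map_smul' := fun c a => by simp }
    ‖φ‖ fun a => by
      have h := φ.le_opNorm (star a)
      rw [norm_star] at h
      simpa using h

end Representation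

/-! ### Operator algebras -/

section Operators

variable (H : Type v) [NormedAddCommGroup H] [InnerProductSpace ℂ H]

/-- The weak* topology on `B(H)`: the coarsest topology for which all functionals
`T ↦ ∑ ⟨T ξₙ | ηₙ⟩` with `∑ ‖ξₙ‖ ‖ηₙ‖ < ∞` are continuous. -/
@[reducible]
def ultraweak : TopologicalSpace (H →L[ℂ] H) :=
  ⨅ (ξ : ℕ → H) (η : ℕ → H) (_ : Summable fun n => ‖ξ n‖ * ‖η n‖),
    TopologicalSpace.induced (fun T => ∑' n, ⟪η n, T (ξ n)⟫_ℂ) inferInstance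

/-- A complex Banach space `E` with a multiplication and an involution is a W*-algebra: these
operations are those of a C*-algebra with a Banach space predual, for the norm of `E`. -/
def IsWStarAlgebra (E : Type u) [NormedAddCommGroup E] [NormedSpace ℂ E]
    (mul : E → E → E) (inv : E → E) : Prop :=
  ∃ (M : Type u) (_ : CStarAlgebra M) (_ : WStarAlgebra M) (e : E ≃ₗᵢ[ℂ] M),
    (∀ x y, e (mul x y) = e x * e y) ∧ ∀ x, e (inv x) = star (e x)

end Operators

end FourierRep

end

noncomputable section

namespace FourierRep

universe u v

/-! ### Elements of the projective tensor product as absolutely convergent series -/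

section Projective

variable {E F : Type*} [NormedAddCommGroup E] [NormedSpace ℂ E]
  [NormedAddCommGroup F] [NormedSpace ℂ F]

/-! Everything rests on one description of the projective tensor product: each element is an
absolutely convergent series of elementary tensors whose cost exceeds the norm by as little as
desired (`exists_hasSum_tmul`). The Riesz theorem turns functionals on the conjugate space into
vectors of `H` without increasing norms, so every φ in the Fourier space is a series ∑ ξₙ *_π ηₙ,
and its norm is the infimum of the costs ∑ ‖ξₙ‖ ‖ηₙ‖. Hence an operation on the Fourier space can be
carried out on coefficients: if it multiplies the cost of each term by at most c, it is bounded by c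
(`exists_fourierIncl_eq`).

A functional μ on the Fourier space gives the bounded sesquilinear form (ξ, η) ↦ μ(ξ *_π η), hence
an operator T = `dualOp μ`. The infimum formula makes μ ↦ T isometric. On coefficients, the module
action, the map φ ↦ μ □ φ and the involution replace the pair (ξ, η) by (ξ, π(a)*η), (Tξ, η) and (η,
ξ). This gives introversion and the isometric involution, and it shows that `dualOp` carries the
Arens product to composition and μ* to the adjoint. The weak* topologies correspond because the
series that make up the Fourier space are those that define the σ-weak topology.

The range of `dualOp` is the σ-weak closure of π(A) by duality, with no appeal to a bicommutant
(`range_dualOp_eq_closure`). The image of A is weak*-dense in the dual because it separates the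
Fourier space. Conversely, an operator in the closure is killed by every normal functional that
kills π(A), so it induces a functional on the Fourier space. As a range, this closure is already a
*-algebra.

Since π may be degenerate, the identity of `H` need not lie in the range. The unit of the W*-algebra
is instead a weak* limit of an approximate unit (`exists_dualOp_unit`), and the Fourier space itself
is the predual. -/

lemma norm_algTensor_def (t : AlgTensor E F) : ‖t‖ = projNorm t := rfl

lemma norm_tmul_le (x : E) (y : F) : ‖tmul x y‖ ≤ ‖x‖ * ‖y‖ := by
  have h := projNorm_le [(x, y)]
  simp only [listTensor, listCost, List.map_cons, List.map_nil, List.sum_cons, List.sum_nil,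
    add_zero] at h
  exact h

lemma exists_listCost_lt (t : AlgTensor E F) {ε : ℝ} (hε : 0 < ε) :
    ∃ l : List (E × F), listTensor l = t ∧ listCost l < ‖t‖ + ε := by
  by_contra! h
  have := le_projNorm h
  rw [norm_algTensor_def] at this
  linarith

/-- Beyond the end of the list the default value contributes nothing, so a finite sum becomes a
series over ℕ. This makes finite tensor representations the rows of a double series. -/
lemma _root_.List.hasSum_getD {α M : Type*} [AddCommMonoid M] [TopologicalSpace M]
    (l : List α) (d : α) (f : α → M) (hd : f d = 0) :
    HasSum (fun i => f (l.getD i d)) (l.map f).sum := by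
  have h : (l.map f).sum = ∑ i ∈ Finset.range l.length, f (l.getD i d) := by
    rw [← Fin.sum_univ_getElem, ← Fin.sum_univ_eq_sum_range (fun i => f (l.getD i d))]
    refine Finset.sum_bij (fun i _ => Fin.cast (by simp) i) (by simp) ?_ ?_ ?_
    · intro a _ b _ h
      simpa [Fin.ext_iff] using h
    · intro b _
      exact ⟨Fin.cast (by simp) b, by simp, by simp⟩
    · intro a _
      have : (a : ℕ) < l.length := by simpa using a.2
      simp [this]
  rw [h]
  refine hasSum_sum_of_ne_finset_zero fun i hi => ?_
  rw [Finset.mem_range, not_lt] at hi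
  rw [List.getD_eq_default _ _ hi, hd]

/-- Every element of the projective tensor product is the sum of an absolutely convergent series
of elementary tensors whose cost is as close to its norm as desired. -/
theorem exists_hasSum_tmul (t : ProjTensor E F) {ε : ℝ} (hε : 0 < ε) :
    ∃ (x : ℕ → E) (y : ℕ → F), (Summable fun n => ‖x n‖ * ‖y n‖) ∧
      HasSum (fun n => ((tmul (x n) (y n) : AlgTensor E F) : ProjTensor E F)) t ∧
      ∑' n, ‖x n‖ * ‖y n‖ < ‖t‖ + ε := by
  -- The approximation errors and the excess costs of the finite representations each sum to 2δ,
  -- which leaves a total excess of 4δ = ε / 2.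
  set δ : ℝ := ε / 8 with hδ
  have hδ0 : 0 < δ := by positivity
  have hgeo : HasSum (fun n : ℕ => δ * (1 / 2 : ℝ) ^ n) (δ * 2) := hasSum_geometric_two.mul_left δ
  let s : AddSubgroup (ProjTensor E F) :=
    (UniformSpace.Completion.toCompl (α := AlgTensor E F)).range
  have hs : t ∈ closure (s : Set (ProjTensor E F)) := UniformSpace.Completion.denseRange_coe t
  obtain ⟨v, hvt, hvs, hv0, hvn⟩ := controlled_sum_of_mem_closure hs
    (b := fun n => δ * (1 / 2 : ℝ) ^ n) (fun n => by positivity)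
  choose w hw using hvs
  have hw' : ∀ n, ((w n : AlgTensor E F) : ProjTensor E F) = v n := hw
  choose l hl hlc using fun n =>
    exists_listCost_lt (w n) (ε := δ * (1 / 2 : ℝ) ^ n) (by positivity)
  have hwn : ∀ n, ‖w n‖ = ‖v n‖ := fun n => by rw [← hw', UniformSpace.Completion.norm_coe]
  -- The zeroth term lies within δ of t, so its row carries ‖t‖. The later terms are small
  -- themselves.
  have hc : ∀ n, listCost (l n) ≤
      (δ * (1 / 2 : ℝ) ^ n + δ * (1 / 2 : ℝ) ^ n) + if n = 0 then ‖t‖ else 0 := by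
    intro n
    refine (hlc n).le.trans ?_
    rw [hwn]
    rcases Nat.eq_zero_or_pos n with rfl | hn
    · have h1 : ‖v 0‖ ≤ ‖v 0 - t‖ + ‖t‖ := by simpa using norm_add_le (v 0 - t) t
      have h2 := hv0.le
      rw [neg_add_eq_sub, norm_sub_rev] at h2
      simp only [if_true]
      linarith
    · rw [if_neg hn.ne']
      linarith [hvn n hn]
  have hmaj : HasSum (fun n : ℕ => (δ * (1 / 2 : ℝ) ^ n + δ * (1 / 2 : ℝ) ^ n) +
      if n = 0 then ‖t‖ else 0) ((δ * 2 + δ * 2) + ‖t‖) :=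
    (hgeo.add hgeo).add (hasSum_ite_eq 0 ‖t‖)
  have hcs : Summable fun n => listCost (l n) :=
    Summable.of_nonneg_of_le (fun n => listCost_nonneg _) hc hmaj.summable
  -- Rows are padded with the pair (0, 0), which has zero tensor and zero cost.
  let z : ℕ × ℕ → E × F := fun p => (l p.1).getD p.2 0
  have hrow : ∀ n, HasSum (fun i => ‖(z (n, i)).1‖ * ‖(z (n, i)).2‖) (listCost (l n)) := fun n =>
    List.hasSum_getD (l n) 0 (fun z => ‖z.1‖ * ‖z.2‖) (by simp)
  have hz : Summable fun p => ‖(z p).1‖ * ‖(z p).2‖ := by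
    rw [summable_prod_of_nonneg (fun p => by positivity)]
    exact ⟨fun n => (hrow n).summable, by simpa only [(hrow _).tsum_eq] using hcs⟩
  have hztsum : ∑' p, ‖(z p).1‖ * ‖(z p).2‖ = ∑' n, listCost (l n) := by
    rw [hz.tsum_prod]
    exact tsum_congr fun n => (hrow n).tsum_eq
  have htens : Summable fun p => ((tmul (z p).1 (z p).2 : AlgTensor E F) : ProjTensor E F) := by
    refine Summable.of_norm_bounded hz fun p => ?_
    rw [UniformSpace.Completion.norm_coe]
    exact norm_tmul_le _ _
  have htrow : ∀ n, HasSum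
      (fun i => ((tmul (z (n, i)).1 (z (n, i)).2 : AlgTensor E F) : ProjTensor E F)) (v n) := by
    intro n
    have h := List.hasSum_getD (l n) 0
      (fun z => ((tmul z.1 z.2 : AlgTensor E F) : ProjTensor E F)) (by
        have h0 : (tmul (0 : E) (0 : F) : AlgTensor E F) = 0 := TensorProduct.zero_tmul _ _
        change ((tmul (0 : E) (0 : F) : AlgTensor E F) : ProjTensor E F) = 0
        rw [h0, UniformSpace.Completion.coe_zero])
    have h2 : ((l n).map fun z => ((tmul z.1 z.2 : AlgTensor E F) : ProjTensor E F)).sum = v n := by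
      rw [← hw' n, ← hl n, listTensor]
      change _ = UniformSpace.Completion.toCompl _
      rw [map_list_sum, List.map_map]
      rfl
    rw [h2] at h
    exact h
  have hsum := htens.hasSum.prod_fiberwise htrow
  -- The approximating sums include the index n, hence the shift by one against sums over
  -- `Finset.range`.
  have hlim : ∑' p, ((tmul (z p).1 (z p).2 : AlgTensor E F) : ProjTensor E F) = t :=
    tendsto_nhds_unique (hsum.tendsto_sum_nat.comp (Filter.tendsto_add_atTop_nat 1)) hvt
  refine ⟨fun n => (z (Nat.pairEquiv.symm n)).1, fun n => (z (Nat.pairEquiv.symm n)).2,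
    (Nat.pairEquiv.symm.summable_iff (f := fun p => ‖(z p).1‖ * ‖(z p).2‖)).2 hz,
    (Nat.pairEquiv.symm.hasSum_iff
      (f := fun p => ((tmul (z p).1 (z p).2 : AlgTensor E F) : ProjTensor E F))).2
      (hlim ▸ htens.hasSum), ?_⟩
  rw [Nat.pairEquiv.symm.tsum_eq (fun p => ‖(z p).1‖ * ‖(z p).2‖), hztsum]
  have := hcs.tsum_le_tsum hc hmaj.summable
  rw [hmaj.tsum_eq] at this
  linarith

end Projective

/-! ### The Fourier space as a Banach quotient -/

section Fourier

variable {A : Type u} [NonUnitalNormedRing A] [NormedSpace ℂ A]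
  {X : Type v} [NormedAddCommGroup X] [NormedSpace ℂ X]

namespace RightAction

/-- The quotient map of the projective tensor product onto the Fourier space. -/
def toFourier (q : RightAction A X) : ProjTensor (StrongDual ℂ X) X →ₗ[ℂ] q.FourierSpace :=
  q.quotEquiv.toLinearMap ∘ₗ (LinearMap.ker q.proj.toLinearMap).mkQ

lemma incl_toFourier (q : RightAction A X) (t : ProjTensor (StrongDual ℂ X) X) :
    q.incl (q.toFourier t) = q.proj t := rfl

lemma incl_injective (q : RightAction A X) : Function.Injective q.incl :=
  Subtype.val_injective

lemma norm_fourier_def (q : RightAction A X) (φ : q.FourierSpace) :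
    ‖φ‖ = ‖q.quotEquiv.symm φ‖ := rfl

lemma norm_toFourier_le (q : RightAction A X) (t : ProjTensor (StrongDual ℂ X) X) :
    ‖q.toFourier t‖ ≤ ‖t‖ := by
  rw [norm_fourier_def, toFourier, LinearMap.comp_apply, LinearEquiv.coe_coe,
    LinearEquiv.symm_apply_apply]
  exact Submodule.Quotient.norm_mk_le _ t

lemma exists_toFourier_eq (q : RightAction A X) (φ : q.FourierSpace) {ε : ℝ} (hε : 0 < ε) :
    ∃ t, q.toFourier t = φ ∧ ‖t‖ < ‖φ‖ + ε := by
  obtain ⟨t, ht, hlt⟩ := Submodule.Quotient.norm_mk_lt (q.quotEquiv.symm φ) hε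
  refine ⟨t, ?_, hlt⟩
  rw [toFourier, LinearMap.comp_apply, Submodule.mkQ_apply, ht]
  exact q.quotEquiv.apply_symm_apply φ

/-- The quotient by the kernel of `p` and the Fourier space are isometric. -/
def quotIsometryEquiv (q : RightAction A X) :
    q.FourierSpace ≃ₗᵢ[ℂ]
      (ProjTensor (StrongDual ℂ X) X ⧸ LinearMap.ker q.proj.toLinearMap) :=
  ⟨q.quotEquiv.symm, fun _ => rfl⟩

instance (q : RightAction A X) : CompleteSpace q.FourierSpace :=
  (completeSpace_congr (e := q.quotIsometryEquiv.toEquiv)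
    q.quotIsometryEquiv.isometry.isUniformEmbedding).2 inferInstance

lemma exists_hasSum_toFourier (q : RightAction A X) (φ : q.FourierSpace) {ε : ℝ} (hε : 0 < ε) :
    ∃ (f : ℕ → StrongDual ℂ X) (x : ℕ → X), (Summable fun n => ‖f n‖ * ‖x n‖) ∧
      HasSum (fun n => q.toFourier (tmul (f n) (x n) : AlgTensor (StrongDual ℂ X) X)) φ ∧
      ∑' n, ‖f n‖ * ‖x n‖ < ‖φ‖ + ε := by
  obtain ⟨t, rfl, ht⟩ := q.exists_toFourier_eq φ (half_pos hε)
  obtain ⟨f, x, hs, hsum, hlt⟩ := exists_hasSum_tmul t (half_pos hε)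
  refine ⟨f, x, hs, ?_, by linarith⟩
  exact hsum.mapL (q.toFourier.mkContinuous 1 fun t => by simpa using q.norm_toFourier_le t)

end RightAction

end Fourier

section Fourier

variable {A : Type u} [NonUnitalNormedRing A] [NormedSpace ℂ A]
  {X : Type v} [NormedAddCommGroup X] [NormedSpace ℂ X]

namespace RightAction

/-- The inclusion of the Fourier space in the dual of `A`, as a bounded operator. -/
def inclL (q : RightAction A X) : q.FourierSpace →L[ℂ] StrongDual ℂ A :=
  q.incl.mkContinuous ‖q.proj‖ fun φ => by
    refine le_of_forall_pos_le_add fun ε hε => ?_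
    -- The added 1 keeps the divisor positive even when p = 0.
    have hc : 0 < ‖q.proj‖ + 1 := by positivity
    obtain ⟨t, rfl, ht⟩ := q.exists_toFourier_eq φ (div_pos hε hc)
    rw [incl_toFourier]
    refine (q.proj.le_opNorm t).trans ((mul_le_mul_of_nonneg_left ht.le (norm_nonneg _)).trans ?_)
    rw [mul_add]
    gcongr
    rw [mul_div_assoc', div_le_iff₀ hc]
    nlinarith

end RightAction

end Fourier

/-! ### Coefficient series and the Fourier norm -/

lemma norm_conjFunctional_le {H : Type v} [NormedAddCommGroup H] [InnerProductSpace ℂ H] (ξ : H) :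
    ‖conjFunctional ξ‖ ≤ ‖ξ‖ :=
  LinearMap.mkContinuous_norm_le _ (norm_nonneg _) _

section Representation

variable {A : Type u} [NonUnitalNormedRing A] [NormedSpace ℂ A] [IsScalarTower ℂ A A]
  [SMulCommClass ℂ A A] [StarRing A] [NormedStarGroup A] [CompleteSpace A]
  {H : Type v} [NormedAddCommGroup H] [InnerProductSpace ℂ H] [CompleteSpace H]

/-- This is the Riesz theorem. Conjugating f cancels the conjugate scalar action and gives a linear
functional on `H`, whose representing vector has the same norm. -/
lemma exists_conjFunctional_eq (f : StrongDual ℂ (Conj H)) :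
    ∃ ξ : H, conjFunctional ξ = f ∧ ‖ξ‖ ≤ ‖f‖ := by
  let g : StrongDual ℂ H := LinearMap.mkContinuous
    { toFun := fun η => conj (f (dot η))
      map_add' := fun x y => by
        rw [← map_add, ← map_add]
        rfl
      map_smul' := fun c x => by
        have h : dot (c • x) = conj c • dot x := by
          change c • x = conj (conj c) • x
          rw [Complex.conj_conj]
        rw [h, map_smul, smul_eq_mul, map_mul, Complex.conj_conj]
        rfl }
    ‖f‖ fun η => by
      refine (RCLike.norm_conj _).le.trans (f.le_opNorm (dot η))
  refine ⟨(InnerProductSpace.toDual ℂ H).symm g, ?_, ?_⟩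
  · ext η
    change ⟪undot η, (InnerProductSpace.toDual ℂ H).symm g⟫_ℂ = f η
    rw [← inner_conj_symm, InnerProductSpace.toDual_symm_apply]
    exact Complex.conj_conj _
  · rw [LinearIsometryEquiv.norm_map]
    exact LinearMap.mkContinuous_norm_le _ (norm_nonneg _) _

variable (π : A →⋆ₙₐ[ℂ] (H →L[ℂ] H))

lemma coeff_apply (ξ η : H) (a : A) : coeff π ξ η a = ⟪η, π a ξ⟫_ℂ := rfl

lemma norm_coeff_le (ξ η : H) : ‖coeff π ξ η‖ ≤ ‖ξ‖ * ‖η‖ := by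
  rw [mul_comm]
  exact LinearMap.mkContinuous_norm_le _ (by positivity) _

lemma toFourier_tmul (ξ η : H) :
    (moduleAction π).toFourier (tmul (conjFunctional ξ) (dot η) : AlgTensor _ _) =
      coeffIn π ξ η := by
  apply (moduleAction π).incl_injective
  rw [RightAction.incl_toFourier]
  refine (projLift_tmul _ _ _).trans ?_
  ext a
  exact ContinuousLinearMap.adjoint_inner_left (π a) ξ η

lemma norm_coeffIn_le (ξ η : H) : ‖coeffIn π ξ η‖ ≤ ‖ξ‖ * ‖η‖ := by
  rw [← toFourier_tmul]
  refine ((moduleAction π).norm_toFourier_le _).trans ?_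
  rw [UniformSpace.Completion.norm_coe]
  exact (norm_tmul_le _ _).trans
    (mul_le_mul_of_nonneg_right (norm_conjFunctional_le ξ) (norm_nonneg _))

variable {π}

/-- Every element of the Fourier space is the sum of a series of coefficients whose cost is as
close to its norm as desired. -/
theorem exists_hasSum_coeffIn (φ : FourierSpaceOf π) {ε : ℝ} (hε : 0 < ε) :
    ∃ ξ η : ℕ → H, (Summable fun n => ‖ξ n‖ * ‖η n‖) ∧
      HasSum (fun n => coeffIn π (ξ n) (η n)) φ ∧ ∑' n, ‖ξ n‖ * ‖η n‖ < ‖φ‖ + ε := by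
  obtain ⟨f, x, hs, hsum, hlt⟩ := (moduleAction π).exists_hasSum_toFourier φ hε
  choose ξ hξ hle using fun n => exists_conjFunctional_eq (f n)
  have hle' : ∀ n, ‖ξ n‖ * ‖undot (x n)‖ ≤ ‖f n‖ * ‖x n‖ := fun n =>
    mul_le_mul_of_nonneg_right (hle n) (norm_nonneg (x n))
  have hs' : Summable fun n => ‖ξ n‖ * ‖undot (x n)‖ :=
    Summable.of_nonneg_of_le (fun n => by positivity) hle' hs
  refine ⟨ξ, fun n => undot (x n), hs', ?_, (hs'.tsum_le_tsum hle' hs).trans_lt hlt⟩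
  convert hsum using 2 with n
  rw [← toFourier_tmul, hξ]
  rfl

theorem summable_coeffIn (π : A →⋆ₙₐ[ℂ] (H →L[ℂ] H)) {ξ η : ℕ → H}
    (h : Summable fun n => ‖ξ n‖ * ‖η n‖) :
    Summable fun n => coeffIn π (ξ n) (η n) :=
  Summable.of_norm_bounded h fun n => norm_coeffIn_le π (ξ n) (η n)

lemma hasSum_fourierIncl {ξ η : ℕ → H} {φ : FourierSpaceOf π}
    (h : HasSum (fun n => coeffIn π (ξ n) (η n)) φ) :
    HasSum (fun n => coeff π (ξ n) (η n)) (fourierIncl π φ) :=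
  h.mapL (moduleAction π).inclL

lemma hasSum_fourierIncl_apply {ξ η : ℕ → H} {φ : FourierSpaceOf π}
    (h : HasSum (fun n => coeffIn π (ξ n) (η n)) φ) (a : A) :
    HasSum (fun n => coeff π (ξ n) (η n) a) (fourierIncl π φ a) :=
  (hasSum_fourierIncl h).mapL (ContinuousLinearMap.apply ℂ ℂ a)

lemma fourierIncl_injective : Function.Injective (fourierIncl π) :=
  (moduleAction π).incl_injective

/-- An absolutely convergent series of coefficients with a given pointwise sum in the Fourier
space converges to it in the Fourier norm. -/
lemma hasSum_coeffIn_of_pointwise {ξ η : ℕ → H} {φ : FourierSpaceOf π}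
    (hs : Summable fun n => ‖ξ n‖ * ‖η n‖)
    (h : ∀ a, HasSum (fun n => coeff π (ξ n) (η n) a) (fourierIncl π φ a)) :
    HasSum (fun n => coeffIn π (ξ n) (η n)) φ := by
  -- Absolute convergence in the complete Fourier space provides some norm limit; its values on A
  -- identify it with φ.
  have h1 := (summable_coeffIn π hs).hasSum
  convert h1
  apply fourierIncl_injective
  ext a
  exact (h a).unique (hasSum_fourierIncl_apply h1 a)

lemma norm_le_tsum {ξ η : ℕ → H} {φ : FourierSpaceOf π}
    (hs : Summable fun n => ‖ξ n‖ * ‖η n‖)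
    (h : HasSum (fun n => coeffIn π (ξ n) (η n)) φ) : ‖φ‖ ≤ ∑' n, ‖ξ n‖ * ‖η n‖ :=
  h.norm_le_of_bounded hs.hasSum fun n => norm_coeffIn_le π (ξ n) (η n)

/-- The Fourier norm is the infimum of the costs of the representing series. -/
theorem isGLB_norm (φ : FourierSpaceOf π) :
    IsGLB {r : ℝ | ∃ ξ η : ℕ → H, (Summable fun n => ‖ξ n‖ * ‖η n‖) ∧
      (∀ a : A, HasSum (fun n => coeff π (ξ n) (η n) a) (fourierIncl π φ a)) ∧
      r = ∑' n, ‖ξ n‖ * ‖η n‖} ‖φ‖ := by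
  constructor
  · rintro _ ⟨ξ, η, hs, h, rfl⟩
    exact norm_le_tsum hs (hasSum_coeffIn_of_pointwise hs h)
  · intro c hc
    refine le_of_forall_pos_le_add fun ε hε => ?_
    obtain ⟨ξ, η, hs, h, hlt⟩ := exists_hasSum_coeffIn φ hε
    exact (hc ⟨ξ, η, hs, hasSum_fourierIncl_apply h, rfl⟩).trans hlt.le

/-- If a number is bounded by a multiple of the cost of every series
representing `φ`, then it is bounded by that multiple of the Fourier norm of `φ`. -/
lemma le_mul_norm_of_forall {φ : FourierSpaceOf π} {r c : ℝ} (hc : 0 ≤ c)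
    (h : ∀ ξ η : ℕ → H, (Summable fun n => ‖ξ n‖ * ‖η n‖) →
      HasSum (fun n => coeffIn π (ξ n) (η n)) φ → r ≤ c * ∑' n, ‖ξ n‖ * ‖η n‖) :
    r ≤ c * ‖φ‖ := by
  refine le_of_forall_pos_le_add fun ε hε => ?_
  have hc' : 0 < c + 1 := by positivity
  obtain ⟨ξ, η, hs, hsum, hlt⟩ := exists_hasSum_coeffIn φ (div_pos hε hc')
  refine (h ξ η hs hsum).trans ((mul_le_mul_of_nonneg_left hlt.le hc).trans ?_)
  rw [mul_add]
  gcongr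
  rw [mul_div_assoc', div_le_iff₀ hc']
  nlinarith

/-- If every series of coefficients representing `φ` can be transformed into one representing `ψ`,
at a cost multiplied by `c`, then `ψ` lies in the Fourier space and its Fourier norm is at most
`c ‖φ‖`. -/
lemma exists_fourierIncl_eq {φ : FourierSpaceOf π} {ψ : StrongDual ℂ A} {c : ℝ} (hc : 0 ≤ c)
    (h : ∀ ξ η : ℕ → H, (Summable fun n => ‖ξ n‖ * ‖η n‖) →
      HasSum (fun n => coeffIn π (ξ n) (η n)) φ → ∃ ξ' η' : ℕ → H,
        (∀ n, ‖ξ' n‖ * ‖η' n‖ ≤ c * (‖ξ n‖ * ‖η n‖)) ∧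
        ∀ a, HasSum (fun n => coeff π (ξ' n) (η' n) a) (ψ a)) :
    ∃ χ : FourierSpaceOf π, fourierIncl π χ = ψ ∧ ‖χ‖ ≤ c * ‖φ‖ := by
  have key : ∀ ξ η : ℕ → H, (Summable fun n => ‖ξ n‖ * ‖η n‖) →
      HasSum (fun n => coeffIn π (ξ n) (η n)) φ →
      ∃ χ : FourierSpaceOf π, fourierIncl π χ = ψ ∧ ‖χ‖ ≤ c * ∑' n, ‖ξ n‖ * ‖η n‖ := by
    intro ξ η hs hsum
    obtain ⟨ξ', η', hle, hψ⟩ := h ξ η hs hsum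
    have hs' : Summable fun n => ‖ξ' n‖ * ‖η' n‖ :=
      Summable.of_nonneg_of_le (fun n => by positivity) hle (hs.mul_left c)
    have hχ := (summable_coeffIn π hs').hasSum
    refine ⟨_, ?_, (norm_le_tsum hs' hχ).trans ?_⟩
    · ext a
      exact (hasSum_fourierIncl_apply hχ a).unique (hψ a)
    · rw [← tsum_mul_left]
      exact hs'.tsum_le_tsum hle (hs.mul_left c)
  -- Any one series produces χ. By injectivity of the inclusion, all other series produce the same
  -- χ, so its norm is bounded by c times every cost and hence by c times the infimum.
  obtain ⟨ξ, η, hs, hsum, -⟩ := exists_hasSum_coeffIn φ one_pos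
  obtain ⟨χ, hχ, -⟩ := key ξ η hs hsum
  refine ⟨χ, hχ, le_mul_norm_of_forall hc fun ξ η hs hsum => ?_⟩
  obtain ⟨χ', hχ', hle⟩ := key ξ η hs hsum
  rwa [fourierIncl_injective (hχ.trans hχ'.symm)]

variable (π) in
-- Acting by a replaces each ηₙ by π(a)*ηₙ, because ⟨π(ab)ξ | η⟩ = ⟨π(b)ξ | π(a)*η⟩. Contractivity
-- of π bounds the new cost.
theorem isLeftHomogeneous_fourierIncl : IsLeftHomogeneous (fourierIncl π) where
  injective := fourierIncl_injective
  complete := inferInstance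
  norm_le φ := by
    rw [← one_mul ‖φ‖]
    refine le_mul_norm_of_forall zero_le_one fun ξ η hs hsum => ?_
    rw [one_mul]
    exact (hasSum_fourierIncl hsum).norm_le_of_bounded hs.hasSum fun n => norm_coeff_le π _ _
  exists_act φ a := by
    rw [mul_comm]
    refine exists_fourierIncl_eq (norm_nonneg a) fun ξ η hs hsum =>
      ⟨ξ, fun n => ContinuousLinearMap.adjoint (π a) (η n), fun n => ?_, fun b => ?_⟩
    · rw [mul_left_comm]
      refine mul_le_mul_of_nonneg_left ?_ (norm_nonneg _)
      refine (ContinuousLinearMap.le_opNorm _ _).trans ?_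
      rw [LinearIsometryEquiv.norm_map]
      exact mul_le_mul_of_nonneg_right (norm_rep_le π a) (norm_nonneg _)
    · change HasSum _ (fourierIncl π φ (a * b))
      convert hasSum_fourierIncl_apply hsum (a * b) using 2 with n
      rw [coeff_apply, coeff_apply, ContinuousLinearMap.adjoint_inner_left, map_mul]
      rfl

lemma act_coeffIn (h : IsLeftHomogeneous (fourierIncl π)) (ξ η : H) (a : A) :
    h.act (coeffIn π ξ η) a = coeffIn π ξ (ContinuousLinearMap.adjoint (π a) η) := by
  apply fourierIncl_injective
  rw [h.ι_act]
  ext b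
  change ⟪η, π (a * b) ξ⟫_ℂ = ⟪ContinuousLinearMap.adjoint (π a) η, π b ξ⟫_ℂ
  rw [ContinuousLinearMap.adjoint_inner_left, map_mul]
  rfl

end Representation

/-! ### Functionals on the Fourier space as operators -/

lemma norm_inner_apply_le {H : Type v} [NormedAddCommGroup H] [InnerProductSpace ℂ H]
    (T : H →L[ℂ] H) (ξ η : H) :
    ‖⟪η, T ξ⟫_ℂ‖ ≤ ‖T‖ * (‖ξ‖ * ‖η‖) := by
  refine (norm_inner_le_norm η (T ξ)).trans ?_
  rw [mul_comm, ← mul_assoc]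
  exact mul_le_mul_of_nonneg_right (T.le_opNorm ξ) (norm_nonneg _)

section Operator

variable {A : Type u} [NonUnitalNormedRing A] [NormedSpace ℂ A] [IsScalarTower ℂ A A]
  [SMulCommClass ℂ A A] [StarRing A] [NormedStarGroup A] [CompleteSpace A]
  {H : Type v} [NormedAddCommGroup H] [InnerProductSpace ℂ H] [CompleteSpace H]
  {π : A →⋆ₙₐ[ℂ] (H →L[ℂ] H)}

/-- The form `(η, ξ) ↦ ⟨μ, ξ *_π η⟩`. -/
def dualForm (μ : StrongDual ℂ (FourierSpaceOf π)) : H →L⋆[ℂ] H →L[ℂ] ℂ :=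
  LinearMap.mkContinuous₂
    (LinearMap.mk₂'ₛₗ (starRingEnd ℂ) (RingHom.id ℂ) (fun η ξ => μ (coeffIn π ξ η))
      (fun η η' ξ => by
        rw [← map_add]
        congr 1
        apply fourierIncl_injective
        ext a
        exact inner_add_left _ _ _)
      (fun c η ξ => by
        rw [← map_smul]
        congr 1
        apply fourierIncl_injective
        ext a
        exact inner_smul_left _ _ _)
      (fun η ξ ξ' => by
        rw [← map_add]
        congr 1
        apply fourierIncl_injective
        ext a
        change ⟪η, π a (ξ + ξ')⟫_ℂ = ⟪η, π a ξ⟫_ℂ + ⟪η, π a ξ'⟫_ℂ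
        rw [map_add, inner_add_right])
      (fun c η ξ => by
        rw [← map_smul]
        congr 1
        apply fourierIncl_injective
        ext a
        change ⟪η, π a (c • ξ)⟫_ℂ = c * ⟪η, π a ξ⟫_ℂ
        rw [map_smul, inner_smul_right]))
    ‖μ‖ fun η ξ => by
      refine (μ.le_opNorm _).trans ?_
      rw [mul_assoc, mul_comm ‖η‖]
      exact mul_le_mul_of_nonneg_left (norm_coeffIn_le π ξ η) (norm_nonneg _)

/-- The operator `T` on `H` with `⟨T ξ | η⟩ = ⟨μ, ξ *_π η⟩`. -/
def dualOp (μ : StrongDual ℂ (FourierSpaceOf π)) : H →L[ℂ] H :=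
  ContinuousLinearMap.adjoint (InnerProductSpace.continuousLinearMapOfBilin (dualForm μ))

lemma inner_dualOp (μ : StrongDual ℂ (FourierSpaceOf π)) (ξ η : H) :
    ⟪η, dualOp μ ξ⟫_ℂ = μ (coeffIn π ξ η) := by
  -- The operator attached to the form acts on η, the conjugate-linear variable; its adjoint acts on
  -- ξ.
  rw [dualOp, ContinuousLinearMap.adjoint_inner_right,
    InnerProductSpace.continuousLinearMapOfBilin_apply]
  rfl

lemma dualOp_eq_of_inner {μ : StrongDual ℂ (FourierSpaceOf π)} {T : H →L[ℂ] H}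
    (h : ∀ ξ η, ⟪η, T ξ⟫_ℂ = μ (coeffIn π ξ η)) : dualOp μ = T := by
  ext ξ
  refine ext_inner_left ℂ fun η => ?_
  rw [inner_dualOp, h]

/-- Testing against η = Tξ, where T = `dualOp μ`, gives ‖Tξ‖² ≤ ‖μ‖ ‖ξ‖ ‖Tξ‖, and a nonzero ‖Tξ‖
cancels. -/
lemma norm_dualOp_le (μ : StrongDual ℂ (FourierSpaceOf π)) : ‖dualOp μ‖ ≤ ‖μ‖ := by
  refine ContinuousLinearMap.opNorm_le_bound _ (norm_nonneg _) fun ξ => ?_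
  obtain h0 | h0 := (norm_nonneg (dualOp μ ξ)).eq_or_lt
  · rw [← h0]
    positivity
  refine le_of_mul_le_mul_right ?_ h0
  rw [← @inner_self_eq_norm_mul_norm ℂ]
  refine (RCLike.re_le_norm _).trans ?_
  rw [inner_dualOp, mul_assoc]
  exact (μ.le_opNorm _).trans
    (mul_le_mul_of_nonneg_left (norm_coeffIn_le π _ _) (norm_nonneg _))

lemma hasSum_inner_dualOp (μ : StrongDual ℂ (FourierSpaceOf π)) {ξ η : ℕ → H}
    {φ : FourierSpaceOf π} (h : HasSum (fun n => coeffIn π (ξ n) (η n)) φ) :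
    HasSum (fun n => ⟪η n, dualOp μ (ξ n)⟫_ℂ) (μ φ) := by
  simpa only [inner_dualOp] using h.mapL μ

/-- Along any series for φ, the terms ⟨Tξₙ | ηₙ⟩ add up to μ(φ), so |μ(φ)| is at most ‖T‖ times the
cost. The infimum over all series gives ‖T‖ ‖φ‖. -/
lemma norm_le_norm_dualOp (μ : StrongDual ℂ (FourierSpaceOf π)) : ‖μ‖ ≤ ‖dualOp μ‖ := by
  refine ContinuousLinearMap.opNorm_le_bound _ (norm_nonneg _) fun φ => ?_
  refine le_mul_norm_of_forall (norm_nonneg _) fun ξ η hs hsum => ?_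
  rw [← tsum_mul_left]
  exact (hasSum_inner_dualOp μ hsum).norm_le_of_bounded (hs.mul_left _).hasSum
    fun n => norm_inner_apply_le _ _ _

variable (π) in
/-- The isometric embedding of the dual of the Fourier space into `B(H)`. -/
def dualOpIsometry : StrongDual ℂ (FourierSpaceOf π) →ₗᵢ[ℂ] (H →L[ℂ] H) where
  toFun := dualOp
  map_add' μ ν := dualOp_eq_of_inner fun ξ η => by
    rw [add_apply, inner_add_right, inner_dualOp, inner_dualOp]
    rfl
  map_smul' c μ := dualOp_eq_of_inner fun ξ η => by
    rw [RingHom.id_apply, smul_apply, inner_smul_right, inner_dualOp]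
    rfl
  norm_map' μ := le_antisymm (norm_dualOp_le μ) (norm_le_norm_dualOp μ)

lemma dualOp_injective :
    Function.Injective (dualOp : StrongDual ℂ (FourierSpaceOf π) → (H →L[ℂ] H)) :=
  (dualOpIsometry π).injective

lemma square_apply (h : IsLeftHomogeneous (fourierIncl π)) (μ : StrongDual ℂ (FourierSpaceOf π))
    (φ : FourierSpaceOf π) (a : A) : h.square μ φ a = μ (h.act φ a) := rfl

lemma act_hasSum (h : IsLeftHomogeneous (fourierIncl π)) {ξ η : ℕ → H} {φ : FourierSpaceOf π}
    (hs : Summable fun n => ‖ξ n‖ * ‖η n‖)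
    (hsum : HasSum (fun n => coeffIn π (ξ n) (η n)) φ) (a : A) :
    HasSum (fun n => coeffIn π (ξ n) (ContinuousLinearMap.adjoint (π a) (η n))) (h.act φ a) := by
  refine hasSum_coeffIn_of_pointwise ?_ fun b => ?_
  · refine Summable.of_nonneg_of_le (fun n => by positivity) (fun n => ?_)
      (hs.mul_left ‖ContinuousLinearMap.adjoint (π a)‖)
    rw [mul_left_comm]
    exact mul_le_mul_of_nonneg_left (ContinuousLinearMap.le_opNorm _ _) (norm_nonneg _)
  · rw [h.ι_act]
    change HasSum _ (fourierIncl π φ (a * b))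
    convert hasSum_fourierIncl_apply hsum (a * b) using 2 with n
    rw [coeff_apply, coeff_apply, ContinuousLinearMap.adjoint_inner_left, map_mul]
    rfl

variable (π) in
/-- The Fourier space is left introverted. -/
theorem isLeftIntroverted_fourierIncl : IsLeftIntroverted (fourierIncl π) where
  toIsLeftHomogeneous := isLeftHomogeneous_fourierIncl π
  exists_square μ φ := by
    -- With T = `dualOp μ`, one has μ((ξ *_π η) · a) = ⟨Tξ | π(a)*η⟩ = ⟨π(a)Tξ | η⟩, so μ □ φ is
    -- represented by the pairs (Tξₙ, ηₙ).
    refine exists_fourierIncl_eq (norm_nonneg μ) fun ξ η hs hsum =>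
      ⟨fun n => dualOp μ (ξ n), η, fun n => ?_, fun a => ?_⟩
    · rw [← mul_assoc]
      refine mul_le_mul_of_nonneg_right ?_ (norm_nonneg _)
      exact (ContinuousLinearMap.le_opNorm _ _).trans
        (mul_le_mul_of_nonneg_right (norm_dualOp_le μ) (norm_nonneg _))
    · rw [square_apply]
      convert hasSum_inner_dualOp μ
        (act_hasSum (isLeftHomogeneous_fourierIncl π) hs hsum a) using 2 with n
      rw [ContinuousLinearMap.adjoint_inner_left]
      rfl

lemma squareIn_coeffIn (h : IsLeftIntroverted (fourierIncl π))
    (μ : StrongDual ℂ (FourierSpaceOf π)) (ξ η : H) :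
    h.squareIn μ (coeffIn π ξ η) = coeffIn π (dualOp μ ξ) η := by
  apply fourierIncl_injective
  rw [h.ι_squareIn]
  ext a
  rw [square_apply, act_coeffIn, ← inner_dualOp, ContinuousLinearMap.adjoint_inner_left]
  rfl

/-- The inner factor ν moves ξ to `dualOp ν ξ` before μ is applied, so the order of the factors is
kept. -/
lemma dualOp_arensMul (h : IsLeftIntroverted (fourierIncl π))
    (μ ν : StrongDual ℂ (FourierSpaceOf π)) :
    dualOp (h.arensMul μ ν) = dualOp μ * dualOp ν :=
  dualOp_eq_of_inner fun ξ η => by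
    change ⟪η, dualOp μ (dualOp ν ξ)⟫_ℂ = μ (h.squareIn ν (coeffIn π ξ η))
    rw [squareIn_coeffIn, inner_dualOp]

lemma dualOp_canonicalMap (h : IsLeftHomogeneous (fourierIncl π)) (a : A) :
    dualOp (h.canonicalMap a) = π a :=
  dualOp_eq_of_inner fun _ _ => rfl

/-! ### Involutions and the operator algebra -/

section Involution

variable [StarModule ℂ A]

lemma starFunctional_apply {A : Type*} [NonUnitalNormedRing A] [NormedSpace ℂ A] [StarRing A]
    [NormedStarGroup A] [StarModule ℂ A] (φ : StrongDual ℂ A) (a : A) :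
    starFunctional φ a = conj (φ (star a)) := rfl

lemma starFunctional_starFunctional {A : Type*} [NonUnitalNormedRing A] [NormedSpace ℂ A]
    [StarRing A] [NormedStarGroup A] [StarModule ℂ A] (φ : StrongDual ℂ A) :
    starFunctional (starFunctional φ) = φ := by
  ext a
  rw [starFunctional_apply, starFunctional_apply, star_star, Complex.conj_conj]

lemma norm_starFunctional {A : Type*} [NonUnitalNormedRing A] [NormedSpace ℂ A] [StarRing A]
    [NormedStarGroup A] [StarModule ℂ A] (φ : StrongDual ℂ A) : ‖starFunctional φ‖ = ‖φ‖ := by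
  have h : ∀ φ : StrongDual ℂ A, ‖starFunctional φ‖ ≤ ‖φ‖ := fun φ =>
    LinearMap.mkContinuous_norm_le _ (norm_nonneg _) _
  refine le_antisymm (h φ) ?_
  simpa only [starFunctional_starFunctional] using h (starFunctional φ)

lemma starFunctional_coeff (ξ η : H) : starFunctional (coeff π ξ η) = coeff π η ξ := by
  ext a
  rw [starFunctional_apply, coeff_apply, coeff_apply, inner_conj_symm, map_star,
    ContinuousLinearMap.star_eq_adjoint, ContinuousLinearMap.adjoint_inner_left]

/-- The involution exchanges ξₙ and ηₙ in each term, and the cost is symmetric in the two. -/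
lemma exists_fourierIncl_eq_star (φ : FourierSpaceOf π) :
    ∃ χ : FourierSpaceOf π, fourierIncl π χ = starFunctional (fourierIncl π φ) ∧
      ‖χ‖ ≤ 1 * ‖φ‖ := by
  refine exists_fourierIncl_eq zero_le_one fun ξ η hs hsum => ⟨η, ξ, fun n => ?_, fun a => ?_⟩
  · rw [one_mul, mul_comm]
  · have h := (hasSum_fourierIncl_apply hsum (star a)).mapL Complex.conjCLE.toContinuousLinearMap
    simp only [← starFunctional_coeff (ξ _) (η _)]
    exact h

/-- The involution `φ ↦ φ*` of the Fourier space. -/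
def fourierStar (φ : FourierSpaceOf π) : FourierSpaceOf π :=
  (exists_fourierIncl_eq_star φ).choose

lemma fourierIncl_fourierStar (φ : FourierSpaceOf π) :
    fourierIncl π (fourierStar φ) = starFunctional (fourierIncl π φ) :=
  (exists_fourierIncl_eq_star φ).choose_spec.1

lemma fourierStar_fourierStar (φ : FourierSpaceOf π) : fourierStar (fourierStar φ) = φ := by
  apply fourierIncl_injective
  rw [fourierIncl_fourierStar, fourierIncl_fourierStar, starFunctional_starFunctional]

lemma norm_fourierStar (φ : FourierSpaceOf π) : ‖fourierStar φ‖ = ‖φ‖ := by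
  have h : ∀ φ : FourierSpaceOf π, ‖fourierStar φ‖ ≤ ‖φ‖ := fun φ => by
    exact (exists_fourierIncl_eq_star φ).choose_spec.2.trans_eq (one_mul _)
  refine le_antisymm (h φ) ?_
  simpa only [fourierStar_fourierStar] using h (fourierStar φ)

lemma fourierStar_coeffIn (ξ η : H) : fourierStar (coeffIn π ξ η) = coeffIn π η ξ := by
  apply fourierIncl_injective
  rw [fourierIncl_fourierStar]
  exact starFunctional_coeff ξ η

lemma fourierStar_add (φ ψ : FourierSpaceOf π) :
    fourierStar (φ + ψ) = fourierStar φ + fourierStar ψ := by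
  apply fourierIncl_injective
  ext a
  simp [fourierIncl_fourierStar, starFunctional_apply]

lemma fourierStar_smul (c : ℂ) (φ : FourierSpaceOf π) :
    fourierStar (c • φ) = conj c • fourierStar φ := by
  apply fourierIncl_injective
  ext a
  simp [fourierIncl_fourierStar, starFunctional_apply]

/-- The involution `μ*(φ) = conj (μ (φ*))` of the dual of the Fourier space. -/
def dualStar (μ : StrongDual ℂ (FourierSpaceOf π)) : StrongDual ℂ (FourierSpaceOf π) :=
  LinearMap.mkContinuous
    { toFun := fun φ => conj (μ (fourierStar φ))
      map_add' := fun φ ψ => by simp [fourierStar_add]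
      map_smul' := fun c φ => by simp [fourierStar_smul] }
    ‖μ‖ fun φ => by
      have h := μ.le_opNorm (fourierStar φ)
      rw [norm_fourierStar] at h
      simpa using h

lemma dualStar_apply (μ : StrongDual ℂ (FourierSpaceOf π)) (φ : FourierSpaceOf π) :
    dualStar μ φ = conj (μ (fourierStar φ)) := rfl

lemma dualOp_dualStar (μ : StrongDual ℂ (FourierSpaceOf π)) :
    dualOp (dualStar μ) = star (dualOp μ) :=
  dualOp_eq_of_inner fun ξ η => by
    rw [dualStar_apply, fourierStar_coeffIn, ← inner_dualOp, inner_conj_symm,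
      ContinuousLinearMap.star_eq_adjoint, ContinuousLinearMap.adjoint_inner_right]

variable (π) in
/-- The von Neumann algebra of `π`: the operators that represent functionals on the Fourier
space. -/
def vonNeumann : NonUnitalStarSubalgebra ℂ (H →L[ℂ] H) where
  carrier := Set.range (dualOpIsometry π)
  add_mem' := by
    rintro _ _ ⟨μ, rfl⟩ ⟨ν, rfl⟩
    exact ⟨μ + ν, map_add _ _ _⟩
  zero_mem' := ⟨0, map_zero _⟩
  -- Products come from the Arens product and adjoints from the dual involution, so no continuity of
  -- operator multiplication is needed.
  mul_mem' := by
    rintro _ _ ⟨μ, rfl⟩ ⟨ν, rfl⟩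
    exact ⟨(isLeftIntroverted_fourierIncl π).arensMul μ ν, dualOp_arensMul _ μ ν⟩
  smul_mem' := by
    rintro c _ ⟨μ, rfl⟩
    exact ⟨c • μ, map_smul _ _ _⟩
  star_mem' := by
    rintro _ ⟨μ, rfl⟩
    exact ⟨dualStar μ, dualOp_dualStar μ⟩

variable (π) in
/-- The isometric isomorphism of the dual of the Fourier space onto the von Neumann algebra. -/
def dualEquiv : StrongDual ℂ (FourierSpaceOf π) ≃ₗᵢ[ℂ] vonNeumann π where
  toFun μ := ⟨dualOp μ, μ, rfl⟩
  map_add' μ ν := Subtype.ext (map_add (dualOpIsometry π) μ ν)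
  map_smul' c μ := Subtype.ext (map_smul (dualOpIsometry π) c μ)
  invFun T := T.2.choose
  left_inv μ := dualOp_injective (Exists.choose_spec (p := fun ν => dualOpIsometry π ν = dualOp μ) _)
  right_inv T := Subtype.ext T.2.choose_spec
  norm_map' μ := (dualOpIsometry π).norm_map μ

lemma coe_dualEquiv (μ : StrongDual ℂ (FourierSpaceOf π)) :
    (dualEquiv π μ : H →L[ℂ] H) = dualOp μ := rfl

end Involution

end Operator

/-! ### Weak density and induced topologies -/

section WeakStar

/-- A linear subspace is dense in a weak topology if it separates the points of the other space of
the pairing. -/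
theorem dense_weakBilin_of_separating {E F : Type*} [AddCommGroup E] [Module ℂ E] [AddCommGroup F]
    [Module ℂ F] (B : E →ₗ[ℂ] F →ₗ[ℂ] ℂ) (V : Submodule ℂ (WeakBilin B))
    (h : ∀ y : F, (∀ x ∈ V, B x y = 0) → y = 0) : Dense (V : Set (WeakBilin B)) := by
  intro μ
  by_contra hμ
  have : ContinuousSMul ℝ (WeakBilin B) := IsScalarTower.continuousSMul ℂ
  have hconv : Convex ℝ (V : Set (WeakBilin B)) := (V.restrictScalars ℝ).convex
  obtain ⟨f, r, hf, hr⟩ := RCLike.geometric_hahn_banach_closed_point (𝕜 := ℂ) hconv.closure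
    isClosed_closure hμ
  have hfV : ∀ ν ∈ V, f ν = 0 := by
    intro ν hν
    by_contra h0
    -- If f ν ≠ 0, the multiple (r / f ν) ν stays in V and takes the value r exactly, against the
    -- strict bound on V.
    have h1 := hf _ (subset_closure (V.smul_mem ((r : ℂ) * (f ν)⁻¹) hν))
    rw [map_smul, smul_eq_mul, mul_assoc, inv_mul_cancel₀ h0, mul_one] at h1
    simp at h1
  -- A continuous functional for the weak topology is a pairing with some y. Separation forces y =
  -- 0, so f = 0 and cannot separate.
  obtain ⟨y, hy⟩ := LinearMap.dualEmbedding_surjective B f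
  have hfy : ∀ ν : WeakBilin B, f ν = B ν y := fun ν => by rw [← hy]; rfl
  have hy0 : y = 0 := h y fun ν hν => by rw [← hfy, hfV ν hν]
  have h2 := hf 0 (subset_closure V.zero_mem)
  rw [hfy, hy0, map_zero] at hr
  simp only [map_zero] at h2 hr
  exact lt_asymm h2 hr

/-- A linear subspace of a dual space that separates the points of the predual is weak*-dense. -/
theorem dense_weakDual_of_separating {X : Type*} [NormedAddCommGroup X] [NormedSpace ℂ X]
    (V : Submodule ℂ (WeakDual ℂ X)) (h : ∀ x : X, (∀ μ ∈ V, μ x = 0) → x = 0) :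
    Dense (V : Set (WeakDual ℂ X)) :=
  dense_weakBilin_of_separating (topDualPairing ℂ X) V h

/-- The hypothesis makes `e` inducing, and an inducing bijection is a homeomorphism. -/
lemma isHomeomorph_of_eq_induced {X Y Z : Type*} [tX : TopologicalSpace X] [tZ : TopologicalSpace Z]
    (e : X ≃ Y) (i : Y → Z) (h : tX = TopologicalSpace.induced (fun x => i (e x)) tZ) :
    @IsHomeomorph X Y tX (TopologicalSpace.induced i tZ) e := by
  let _ : TopologicalSpace Y := TopologicalSpace.induced i tZ
  have he : Topology.IsInducing e := ⟨by rw [h, induced_compose]; rfl⟩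
  exact (e.toHomeomorphOfIsInducing he).isHomeomorph

lemma isHomeomorph_symm_of_eq_induced {X Y Z : Type*} [tX : TopologicalSpace X]
    [tZ : TopologicalSpace Z] (e : X ≃ Y) (i : Y → Z)
    (h : tX = TopologicalSpace.induced (fun x => i (e x)) tZ) :
    @IsHomeomorph Y X (TopologicalSpace.induced i tZ) tX e.symm := by
  let _ : TopologicalSpace Y := TopologicalSpace.induced i tZ
  have he : Topology.IsInducing e := ⟨by rw [h, induced_compose]; rfl⟩
  exact (e.toHomeomorphOfIsInducing he).symm.isHomeomorph

end WeakStar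

/-! ### W*-algebra structures on dual Banach spaces -/

section WStar

variable {X : Type u} [NormedAddCommGroup X] [NormedSpace ℂ X]

/-- A multiplication with a unit and an involution on a dual Banach space that admit an isometric
`*`-homomorphism to a C*-algebra make it a W*-algebra. -/
theorem isWStarAlgebra_of_isometry [CompleteSpace X] {B : Type*} [NonUnitalCStarAlgebra B]
    (Φ : StrongDual ℂ X →ₗᵢ[ℂ] B) {mul : StrongDual ℂ X → StrongDual ℂ X → StrongDual ℂ X}
    {inv : StrongDual ℂ X → StrongDual ℂ X} (hmul : ∀ x y, Φ (mul x y) = Φ x * Φ y)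
    (hinv : ∀ x, Φ (inv x) = star (Φ x)) (e : StrongDual ℂ X)
    (hel : ∀ x, mul e x = x) (her : ∀ x, mul x e = x) :
    IsWStarAlgebra (StrongDual ℂ X) mul inv := by
  let ring : NormedRing (StrongDual ℂ X) :=
    { (inferInstance : NormedAddCommGroup (StrongDual ℂ X)) with
      mul := mul
      one := e
      mul_assoc := fun x y z => Φ.injective
        (show Φ (mul (mul x y) z) = Φ (mul x (mul y z)) by simp only [hmul, mul_assoc])
      left_distrib := fun x y z => Φ.injective
        (show Φ (mul x (y + z)) = Φ (mul x y + mul x z) by simp only [hmul, map_add, mul_add])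
      right_distrib := fun x y z => Φ.injective
        (show Φ (mul (x + y) z) = Φ (mul x z + mul y z) by simp only [hmul, map_add, add_mul])
      zero_mul := fun x => Φ.injective
        (show Φ (mul 0 x) = Φ 0 by simp only [hmul, map_zero, zero_mul])
      mul_zero := fun x => Φ.injective
        (show Φ (mul x 0) = Φ 0 by simp only [hmul, map_zero, mul_zero])
      one_mul := hel
      mul_one := her
      norm_mul_le := fun x y => by
        change ‖mul x y‖ ≤ ‖x‖ * ‖y‖
        rw [← Φ.norm_map, hmul, ← Φ.norm_map x, ← Φ.norm_map y]
        exact norm_mul_le _ _ }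
  have hmul' : ∀ x y : StrongDual ℂ X, Φ (x * y) = Φ x * Φ y := hmul
  let alg : NormedAlgebra ℂ (StrongDual ℂ X) :=
    { Algebra.ofModule
        (fun c x y => Φ.injective (by simp only [hmul', map_smul, smul_mul_assoc]))
        (fun c x y => Φ.injective (by simp only [hmul', map_smul, mul_smul_comm])) with
      norm_smul_le := fun c x => norm_smul_le c x }
  let starRing : StarRing (StrongDual ℂ X) :=
    { star := inv
      star_involutive := fun x => Φ.injective (by
        change Φ (inv (inv x)) = Φ x
        rw [hinv, hinv, star_star])
      star_mul := fun x y => Φ.injective (by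
        change Φ (inv (x * y)) = Φ (inv y * inv x)
        rw [hinv, hmul', hmul', hinv, hinv, star_mul])
      star_add := fun x y => Φ.injective (by
        change Φ (inv (x + y)) = Φ (inv x + inv y)
        rw [hinv, map_add, map_add, hinv, hinv, star_add]) }
  have hinv' : ∀ x : StrongDual ℂ X, Φ (star x) = star (Φ x) := hinv
  let cstar : CStarAlgebra (StrongDual ℂ X) :=
    { ring, alg, starRing with
      complete := CompleteSpace.complete
      norm_mul_self_le := fun x => by
        rw [← Φ.norm_map (star x * x), hmul', hinv', ← Φ.norm_map x,
          CStarRing.norm_star_mul_self]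
      star_smul := fun c x => Φ.injective (by
        change Φ (star (c • x)) = Φ (star c • star x)
        rw [hinv', map_smul, map_smul, hinv', star_smul]) }
  have hstar : ∀ x : StrongDual ℂ X, ‖star x‖ = ‖x‖ := fun x => norm_star x
  -- The predual identification is required to be conjugate-linear, so the involution serves as the
  -- isometry in place of the identity.
  have wstar : WStarAlgebra (StrongDual ℂ X) :=
    ⟨X, inferInstance, inferInstance, inferInstance,
      ⟨{ toFun := fun x => star x
         invFun := fun x => star x
         left_inv := star_star
         right_inv := star_star
         map_add' := star_add
         map_smul' := star_smul
         norm_map' := hstar }⟩⟩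
  exact ⟨StrongDual ℂ X, cstar, wstar, LinearIsometryEquiv.refl ℂ _, fun _ _ => rfl, fun _ => rfl⟩

end WStar

/-! ### The σ-weak topology and the closure of π(A) -/

section Topology

lemma continuous_ultraweak_tsum {H : Type v} [NormedAddCommGroup H] [InnerProductSpace ℂ H]
    {ξ η : ℕ → H} (hs : Summable fun n => ‖ξ n‖ * ‖η n‖) :
    @Continuous (H →L[ℂ] H) ℂ (ultraweak H) _ (fun T => ∑' n, ⟪η n, T (ξ n)⟫_ℂ) :=
  continuous_iff_le_induced.2
    ((iInf_le _ ξ).trans ((iInf_le _ η).trans (iInf_le _ hs)))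

lemma continuous_ultraweak_rng {H : Type v} [NormedAddCommGroup H] [InnerProductSpace ℂ H]
    {Y : Type*} [TopologicalSpace Y] {f : Y → (H →L[ℂ] H)}
    (h : ∀ ξ η : ℕ → H, (Summable fun n => ‖ξ n‖ * ‖η n‖) →
      Continuous fun y => ∑' n, ⟪η n, f y (ξ n)⟫_ℂ) :
    @Continuous Y (H →L[ℂ] H) _ (ultraweak H) f :=
  continuous_iInf_rng.2 fun ξ => continuous_iInf_rng.2 fun η => continuous_iInf_rng.2 fun hs =>
    continuous_induced_rng.2 (h ξ η hs)

variable {A : Type u} [NonUnitalNormedRing A] [NormedSpace ℂ A] [IsScalarTower ℂ A A]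
  [SMulCommClass ℂ A A] [StarRing A] [NormedStarGroup A] [CompleteSpace A]
  {H : Type v} [NormedAddCommGroup H] [InnerProductSpace ℂ H] [CompleteSpace H]
  {π : A →⋆ₙₐ[ℂ] (H →L[ℂ] H)}

/-- Pulled back along `dualOp`, the functional T ↦ ∑ ⟨Tξₙ | ηₙ⟩ is evaluation at the element ∑ ξₙ
*_π ηₙ. -/
lemma continuous_dualOp :
    @Continuous (WeakDual ℂ (FourierSpaceOf π)) (H →L[ℂ] H) _ (ultraweak H)
      (fun μ => dualOp (WeakDual.toStrongDual μ)) := by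
  refine continuous_ultraweak_rng fun ξ η hs => ?_
  have h := (summable_coeffIn π hs).hasSum
  simp only [(hasSum_inner_dualOp _ h).tsum_eq]
  exact WeakDual.eval_continuous _

variable (π) in
/-- The weak* topology of the dual of the Fourier space is induced by that of `B(H)`. -/
theorem weakDual_topology_eq :
    (inferInstance : TopologicalSpace (WeakDual ℂ (FourierSpaceOf π))) =
      TopologicalSpace.induced (fun μ => dualOp (WeakDual.toStrongDual μ)) (ultraweak H) := by
  refine le_antisymm (continuous_iff_le_induced.1 continuous_dualOp) ?_
  refine @Continuous.le_induced _ _ (TopologicalSpace.induced _ (ultraweak H))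
    Pi.topologicalSpace (fun (μ : WeakDual ℂ (FourierSpaceOf π)) φ => μ φ)
    (@continuous_pi _ _ _ (TopologicalSpace.induced _ (ultraweak H)) _ _ fun φ => ?_)
  -- Conversely, a series for φ exhibits evaluation at φ as one of the functionals that define the
  -- σ-weak topology.
  obtain ⟨ξ, η, hs, hφ, -⟩ := exists_hasSum_coeffIn φ one_pos
  convert @Continuous.comp _ _ _ (TopologicalSpace.induced _ (ultraweak H)) (ultraweak H) _ _ _
    (continuous_ultraweak_tsum hs) (@continuous_induced_dom _ _
      (fun μ : WeakDual ℂ (FourierSpaceOf π) => dualOp (WeakDual.toStrongDual μ))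
      (ultraweak H)) using 1
  funext μ
  exact (hasSum_inner_dualOp (WeakDual.toStrongDual μ) hφ).tsum_eq.symm

variable (π) in
/-- The representation `π` as a bounded operator. -/
def repL : A →L[ℂ] (H →L[ℂ] H) :=
  LinearMap.mkContinuous
    { toFun := π
      map_add' := map_add π
      map_smul' := map_smul π } 1 fun a => by
        rw [one_mul]
        exact norm_rep_le π a

variable (H) in
/-- The space of ultraweakly continuous functionals on `B(H)`. -/
abbrev Normal : Type v := FourierSpaceOf (NonUnitalStarAlgHom.id ℂ (H →L[ℂ] H))

variable (π) in
-- Normal functionals form the Fourier space of the identity representation of B(H). The vectors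
-- that represent ω there also represent ω ∘ π as a series of coefficients of π.
lemma exists_restrict (ω : Normal H) :
    ∃ φ : FourierSpaceOf π, fourierIncl π φ =
      fourierIncl (NonUnitalStarAlgHom.id ℂ (H →L[ℂ] H)) ω ∘L repL π := by
  obtain ⟨ξ, η, hs, hω, -⟩ := exists_hasSum_coeffIn ω one_pos
  have h := (summable_coeffIn π hs).hasSum
  refine ⟨∑' n, coeffIn π (ξ n) (η n), ?_⟩
  ext a
  exact (hasSum_fourierIncl_apply h a).unique (hasSum_fourierIncl_apply hω (π a))

variable (π) in
/-- The restriction `ω ↦ ω ∘ π` of ultraweakly continuous functionals to elements of the Fourier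
space. -/
def restrict : Normal H →ₗ[ℂ] FourierSpaceOf π where
  toFun ω := (exists_restrict π ω).choose
  map_add' ω ω' := by
    apply fourierIncl_injective
    rw [map_add (fourierIncl π), (exists_restrict π (ω + ω')).choose_spec,
      (exists_restrict π ω).choose_spec, (exists_restrict π ω').choose_spec, map_add,
      ContinuousLinearMap.add_comp]
  map_smul' c ω := by
    apply fourierIncl_injective
    rw [RingHom.id_apply, map_smul (fourierIncl π), (exists_restrict π (c • ω)).choose_spec,
      (exists_restrict π ω).choose_spec, map_smul, ContinuousLinearMap.smul_comp]

lemma fourierIncl_restrict (ω : Normal H) (a : A) :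
    fourierIncl π (restrict π ω) a =
      fourierIncl (NonUnitalStarAlgHom.id ℂ (H →L[ℂ] H)) ω (π a) :=
  DFunLike.congr_fun (exists_restrict π ω).choose_spec a

lemma hasSum_restrict {ξ η : ℕ → H} {ω : Normal H}
    (hs : Summable fun n => ‖ξ n‖ * ‖η n‖)
    (h : HasSum (fun n => coeffIn (NonUnitalStarAlgHom.id ℂ (H →L[ℂ] H)) (ξ n) (η n)) ω) :
    HasSum (fun n => coeffIn π (ξ n) (η n)) (restrict π ω) := by
  refine hasSum_coeffIn_of_pointwise hs fun a => ?_
  rw [fourierIncl_restrict]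
  exact hasSum_fourierIncl_apply h (π a)

lemma exists_restrict_eq {φ : FourierSpaceOf π} {ξ η : ℕ → H}
    (hs : Summable fun n => ‖ξ n‖ * ‖η n‖) (h : HasSum (fun n => coeffIn π (ξ n) (η n)) φ) :
    ∃ ω : Normal H, restrict π ω = φ ∧
      HasSum (fun n => coeffIn (NonUnitalStarAlgHom.id ℂ (H →L[ℂ] H)) (ξ n) (η n)) ω := by
  have hω := (summable_coeffIn (NonUnitalStarAlgHom.id ℂ (H →L[ℂ] H)) hs).hasSum
  exact ⟨_, (hasSum_restrict hs hω).unique h, hω⟩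

lemma restrict_surjective : Function.Surjective (restrict π) := fun φ => by
  obtain ⟨ξ, η, hs, hφ, -⟩ := exists_hasSum_coeffIn φ one_pos
  obtain ⟨ω, hω, -⟩ := exists_restrict_eq hs hφ
  exact ⟨ω, hω⟩

/-- An operator annihilated by all ultraweakly continuous functionals that annihilate `π(A)` comes
from a functional on the Fourier space. -/
theorem mem_range_dualOp_of_annihilator {T : H →L[ℂ] H}
    (hT : ∀ ω : Normal H, restrict π ω = 0 →
      fourierIncl (NonUnitalStarAlgHom.id ℂ (H →L[ℂ] H)) ω T = 0) :
    ∃ μ : StrongDual ℂ (FourierSpaceOf π), dualOp μ = T := by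
  set j := fourierIncl (NonUnitalStarAlgHom.id ℂ (H →L[ℂ] H))
  -- The functional ω ↦ ω(T) vanishes on the kernel of the restriction and so descends to the
  -- Fourier space. Any linear section computes it; the section need not be continuous, since its
  -- choice does not affect the value.
  obtain ⟨s, hs⟩ := (restrict π).exists_rightInverse_of_surjective
    (LinearMap.range_eq_top.2 restrict_surjective)
  have hval : ∀ ω : Normal H, j (s (restrict π ω)) T = j ω T := by
    intro ω
    have h0 : restrict π (s (restrict π ω) - ω) = 0 := by
      rw [map_sub, ← LinearMap.comp_apply, hs, LinearMap.id_apply, sub_self]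
    have h1 := hT _ h0
    rwa [map_sub, sub_apply, sub_eq_zero] at h1
  -- The descended functional is computed by every series for φ, which bounds it by ‖T‖ times the
  -- Fourier norm.
  have hsum : ∀ (φ : FourierSpaceOf π) (ξ η : ℕ → H), (Summable fun n => ‖ξ n‖ * ‖η n‖) →
      HasSum (fun n => coeffIn π (ξ n) (η n)) φ →
      HasSum (fun n => ⟪η n, T (ξ n)⟫_ℂ) (j (s φ) T) := by
    intro φ ξ η hs' hφ
    obtain ⟨ω, rfl, hω⟩ := exists_restrict_eq hs' hφ
    rw [hval]
    exact hasSum_fourierIncl_apply hω T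
  let μ : StrongDual ℂ (FourierSpaceOf π) := LinearMap.mkContinuous
    { toFun := fun φ => j (s φ) T
      map_add' := fun φ ψ => by simp
      map_smul' := fun c φ => by simp } ‖T‖ fun φ => by
        refine le_mul_norm_of_forall (norm_nonneg _) fun ξ η hs' hφ => ?_
        rw [← tsum_mul_left]
        exact (hsum φ ξ η hs' hφ).norm_le_of_bounded (hs'.mul_left _).hasSum
          fun n => norm_inner_apply_le _ _ _
  refine ⟨μ, dualOp_eq_of_inner fun ξ η => ?_⟩
  let ω : Normal H := coeffIn (NonUnitalStarAlgHom.id ℂ (H →L[ℂ] H)) ξ η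
  have hω : restrict π ω = coeffIn π ξ η := by
    apply fourierIncl_injective
    ext a
    exact fourierIncl_restrict ω a
  change _ = j (s (coeffIn π ξ η)) T
  rw [← hω, hval]
  rfl

lemma continuous_normal (ω : Normal H) :
    @Continuous (H →L[ℂ] H) ℂ (ultraweak H) _
      (fun T => fourierIncl (NonUnitalStarAlgHom.id ℂ (H →L[ℂ] H)) ω T) := by
  obtain ⟨ξ, η, hs, hω, -⟩ := exists_hasSum_coeffIn ω one_pos
  convert continuous_ultraweak_tsum hs using 1
  funext T
  exact (hasSum_fourierIncl_apply hω T).tsum_eq.symm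

/-- The range of the dual of the Fourier space is the ultraweak closure of `π(A)`. -/
theorem range_dualOp_eq_closure :
    Set.range (dualOp : StrongDual ℂ (FourierSpaceOf π) → (H →L[ℂ] H)) =
      @closure _ (ultraweak H) (Set.range π) := by
  let _ : TopologicalSpace (H →L[ℂ] H) := ultraweak H
  have hhom := isLeftHomogeneous_fourierIncl π
  refine Set.Subset.antisymm ?_ ?_
  · rintro _ ⟨μ, rfl⟩
    let V : Submodule ℂ (WeakDual ℂ (FourierSpaceOf π)) := LinearMap.range
      (show A →ₗ[ℂ] WeakDual ℂ (FourierSpaceOf π) from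
        { toFun := fun a => StrongDual.toWeakDual (hhom.canonicalMap a)
          map_add' := fun a b => DFunLike.ext _ _ fun φ => map_add (fourierIncl π φ) a b
          map_smul' := fun c a => DFunLike.ext _ _ fun φ => map_smul (fourierIncl π φ) c a })
    have hV : Dense (V : Set (WeakDual ℂ (FourierSpaceOf π))) := by
      refine dense_weakDual_of_separating V fun φ hφ => ?_
      apply fourierIncl_injective
      rw [map_zero]
      ext a
      -- Elements of the Fourier space are functionals on A, so the image of A separates them.
      exact hφ _ ⟨a, rfl⟩
    have h1 := image_closure_subset_closure_image (continuous_dualOp (π := π))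
      ⟨StrongDual.toWeakDual μ, hV _, rfl⟩
    refine closure_mono ?_ h1
    rintro _ ⟨_, ⟨a, rfl⟩, rfl⟩
    exact ⟨a, (dualOp_canonicalMap hhom a).symm⟩
  · intro T hT
    refine mem_range_dualOp_of_annihilator fun ω hω => ?_
    have hc : IsClosed {T : H →L[ℂ] H |
        fourierIncl (NonUnitalStarAlgHom.id ℂ (H →L[ℂ] H)) ω T = 0} :=
      isClosed_eq (continuous_normal ω) continuous_const
    refine closure_minimal ?_ hc hT
    rintro _ ⟨a, rfl⟩
    rw [Set.mem_ofPred_eq, ← fourierIncl_restrict, hω, map_zero]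
    rfl

end Topology

/-! ### The unit of the von Neumann algebra of a possibly degenerate representation -/

section Unit

variable {A : Type u} [NonUnitalNormedRing A] [NormedSpace ℂ A] [IsScalarTower ℂ A A]
  [SMulCommClass ℂ A A] [StarRing A] [NormedStarGroup A] [CompleteSpace A] [StarModule ℂ A]
  {H : Type v} [NormedAddCommGroup H] [InnerProductSpace ℂ H] [CompleteSpace H]

/-- The von Neumann algebra of `π` has a unit, a weak* cluster point of its approximate unit. -/
theorem exists_dualOp_unit (π : A →⋆ₙₐ[ℂ] (H →L[ℂ] H)) :
    ∃ e : StrongDual ℂ (FourierSpaceOf π), ∀ μ : StrongDual ℂ (FourierSpaceOf π),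
      dualOp e * dualOp μ = dualOp μ ∧ dualOp μ * dualOp e = dualOp μ := by
  -- The isometric image of a complete space is norm-closed. The operators therefore form a
  -- C*-algebra, which has an increasing approximate unit of norm eventually at most 1.
  have hcl : IsClosed (vonNeumann π : Set (H →L[ℂ] H)) :=
    (dualOpIsometry π).isometry.isClosedEmbedding.isClosed_range
  let _ : NonUnitalCStarAlgebra (vonNeumann π) :=
    NonUnitalStarSubalgebra.nonUnitalCStarAlgebra (vonNeumann π)
  let _ : PartialOrder (vonNeumann π) := CStarAlgebra.spectralOrder (vonNeumann π)
  have : StarOrderedRing (vonNeumann π) := CStarAlgebra.spectralOrderedRing (vonNeumann π)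
  have hl := CStarAlgebra.increasingApproximateUnit (vonNeumann π)
  let U : Ultrafilter (vonNeumann π) := Ultrafilter.of (CStarAlgebra.approximateUnit (vonNeumann π))
  have hU : (U : Filter (vonNeumann π)) ≤ CStarAlgebra.approximateUnit (vonNeumann π) :=
    Ultrafilter.of_le _
  let f : vonNeumann π → WeakDual ℂ (FourierSpaceOf π) :=
    fun T => StrongDual.toWeakDual ((dualEquiv π).symm T)
  have hf : ∀ T ξ η, f T (coeffIn π ξ η) = ⟪η, (T : H →L[ℂ] H) ξ⟫_ℂ := by
    intro T ξ η
    change (dualEquiv π).symm T (coeffIn π ξ η) = _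
    rw [← inner_dualOp, ← coe_dualEquiv, LinearIsometryEquiv.apply_symm_apply]
  -- The unit ball of the dual is weak*-compact, so the approximate unit converges along an
  -- ultrafilter.
  obtain ⟨e, -, he⟩ := isCompact_iff_ultrafilter_le_nhds.1
    (WeakDual.isCompact_closedBall (𝕜 := ℂ) (0 : StrongDual ℂ (FourierSpaceOf π)) 1) (U.map f) (by
      rw [Filter.le_principal_iff]
      refine Filter.mem_map.2 (hU ?_)
      filter_upwards [hl.eventually_norm] with T hT
      rw [Set.mem_preimage, Set.mem_preimage, mem_closedBall_zero_iff]
      exact ((dualEquiv π).symm.norm_map T).trans_le hT)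
  have he' : Filter.Tendsto f U (nhds e) := he
  have hlim : ∀ ξ η, Filter.Tendsto (fun T : vonNeumann π => ⟪η, (T : H →L[ℂ] H) ξ⟫_ℂ) U
      (nhds ⟪η, dualOp (WeakDual.toStrongDual e) ξ⟫_ℂ) := by
    intro ξ η
    rw [inner_dualOp]
    simp only [← hf]
    exact ((WeakDual.eval_continuous (coeffIn π ξ η)).tendsto e).comp he'
  have hcont : ∀ ξ η, Continuous fun T : vonNeumann π => ⟪η, (T : H →L[ℂ] H) ξ⟫_ℂ := by
    intro ξ η
    have h1 : Continuous fun T : vonNeumann π => (T : H →L[ℂ] H) := continuous_subtype_val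
    fun_prop
  refine ⟨WeakDual.toStrongDual e, fun μ => ?_⟩
  constructor
  · ext ξ
    refine ext_inner_left ℂ fun η => ?_
    -- The products with the approximate unit converge in norm to `dualOp μ`, while their matrix
    -- entries converge to those of the product with e.
    have h1 := ((hcont ξ η).tendsto _).comp ((hl.tendsto_mul_right (dualEquiv π μ)).mono_left hU)
    exact tendsto_nhds_unique (hlim (dualOp μ ξ) η) h1
  · ext ξ
    refine ext_inner_left ℂ fun η => ?_
    have h1 := ((hcont ξ η).tendsto _).comp ((hl.tendsto_mul_left (dualEquiv π μ)).mono_left hU)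
    -- Only matrix entries converge to those of e, so the left factor `dualOp μ` is moved onto η by
    -- its adjoint.
    have h2 := hlim ξ (ContinuousLinearMap.adjoint (dualOp μ) η)
    simp only [ContinuousLinearMap.adjoint_inner_left] at h2
    exact tendsto_nhds_unique h2 h1

end Unit

/-! ### The W*-algebra and minimality statements -/

section Main

variable {A : Type u} [NonUnitalNormedRing A] [NormedSpace ℂ A] [IsScalarTower ℂ A A]
  [SMulCommClass ℂ A A] [StarRing A] [NormedStarGroup A] [CompleteSpace A] [StarModule ℂ A]
  {H : Type v} [NormedAddCommGroup H] [InnerProductSpace ℂ H] [CompleteSpace H]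
  (π : A →⋆ₙₐ[ℂ] (H →L[ℂ] H))

/-- The dual of the Fourier space is a W*-algebra. -/
theorem isWStarAlgebra_dual (h : IsLeftIntroverted (fourierIncl π)) :
    IsWStarAlgebra (StrongDual ℂ (FourierSpaceOf π)) h.arensMul dualStar := by
  obtain ⟨e, he⟩ := exists_dualOp_unit π
  refine isWStarAlgebra_of_isometry (dualOpIsometry π) (dualOp_arensMul h) dualOp_dualStar e
    (fun μ => dualOp_injective ?_) (fun μ => dualOp_injective ?_)
  · rw [dualOp_arensMul, (he μ).1]
  · rw [dualOp_arensMul, (he μ).2]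

lemma coe_vonNeumann :
    (vonNeumann π : Set (H →L[ℂ] H)) = @closure _ (ultraweak H) (Set.range π) :=
  range_dualOp_eq_closure

/-- The von Neumann algebra of `π` is the smallest ultraweakly closed `*`-subalgebra that
contains `π(A)`. -/
theorem isLeast_vonNeumann :
    IsLeast {M : NonUnitalStarSubalgebra ℂ (H →L[ℂ] H) |
      Set.range π ⊆ M ∧ @IsClosed _ (ultraweak H) (M : Set (H →L[ℂ] H))} (vonNeumann π) := by
  let _ : TopologicalSpace (H →L[ℂ] H) := ultraweak H
  refine ⟨⟨?_, ?_⟩, fun M hM => ?_⟩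
  · rw [coe_vonNeumann]
    exact subset_closure
  · rw [coe_vonNeumann]
    exact isClosed_closure
  · rw [← SetLike.coe_subset_coe, coe_vonNeumann]
    exact closure_minimal hM.1 hM.2

end Main

end FourierRep

end

open FourierRep in
theorem mainTheorem8 {A : Type*} [NonUnitalNormedRing A] [NormedSpace ℂ A] [IsScalarTower ℂ A A]
    [SMulCommClass ℂ A A] [CompleteSpace A] [StarRing A] [StarModule ℂ A] [NormedStarGroup A]
    {H : Type*} [NormedAddCommGroup H] [InnerProductSpace ℂ H] [CompleteSpace H]
    (π : A →⋆ₙₐ[ℂ] (H →L[ℂ] H)) :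
    -- (a) absolutely convergent sums of coefficients lie in the Fourier space and converge there,
    -- they exhaust it, and the Fourier norm is the infimum of their costs
    (∀ ξ η : ℕ → H, (Summable fun n => ‖ξ n‖ * ‖η n‖) →
      ∃ φ : FourierSpaceOf π,
        (∀ a : A, Filter.Tendsto (fun N => ∑ n ∈ Finset.range N, coeff π (ξ n) (η n) a)
          Filter.atTop (nhds (fourierIncl π φ a))) ∧
        HasSum (fun n => coeffIn π (ξ n) (η n)) φ) ∧
    (∀ φ : FourierSpaceOf π, ∃ ξ η : ℕ → H, (Summable fun n => ‖ξ n‖ * ‖η n‖) ∧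
      HasSum (fun n => coeffIn π (ξ n) (η n)) φ) ∧
    (∀ φ : FourierSpaceOf π,
      IsGLB {r : ℝ | ∃ ξ η : ℕ → H, (Summable fun n => ‖ξ n‖ * ‖η n‖) ∧
        (∀ a : A, HasSum (fun n => coeff π (ξ n) (η n) a) (fourierIncl π φ a)) ∧
        r = ∑' n, ‖ξ n‖ * ‖η n‖} ‖φ‖) ∧
    -- (b) left introverted homogeneous subspace, closed under the isometric involution `J`
    ∃ hI : IsLeftIntroverted (fourierIncl π),
    ∃ J : FourierSpaceOf π → FourierSpaceOf π,
      (∀ φ, fourierIncl π (J φ) = starFunctional (fourierIncl π φ)) ∧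
      (∀ ξ η : H, starFunctional (coeff π ξ η) = coeff π η ξ) ∧
      (∀ φ : StrongDual ℂ A, ‖starFunctional φ‖ = ‖φ‖) ∧
      (∀ φ, ‖J φ‖ = ‖φ‖) ∧
    -- (c) the dual is a W*-algebra for the Arens product and the involution `inv`
    ∃ inv : StrongDual ℂ (FourierSpaceOf π) → StrongDual ℂ (FourierSpaceOf π),
      (∀ μ φ, inv μ φ = conj (μ (J φ))) ∧
      IsWStarAlgebra (StrongDual ℂ (FourierSpaceOf π)) hI.arensMul inv ∧
    -- the weak* closure of `π(A)`, the von Neumann subalgebra generated by `π(A)`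
    ∃ VN : NonUnitalStarSubalgebra ℂ (H →L[ℂ] H),
      (VN : Set (H →L[ℂ] H)) = @closure _ (ultraweak H) (Set.range π) ∧
      IsLeast {M : NonUnitalStarSubalgebra ℂ (H →L[ℂ] H) |
        Set.range π ⊆ M ∧ @IsClosed _ (ultraweak H) (M : Set (H →L[ℂ] H))} VN ∧
      (∃ Φ : StrongDual ℂ (FourierSpaceOf π) ≃ₗᵢ[ℂ] VN,
        (∀ μ ξ η, inner ℂ η ((Φ μ : H →L[ℂ] H) ξ) = μ (coeffIn π ξ η)) ∧
        (∀ μ ν, Φ (hI.arensMul μ ν) = Φ μ * Φ ν) ∧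
        (∀ μ, Φ (inv μ) = star (Φ μ)) ∧
        @IsHomeomorph (WeakDual ℂ (FourierSpaceOf π)) VN inferInstance
          (TopologicalSpace.induced Subtype.val (ultraweak H))
          (fun μ => Φ (WeakDual.toStrongDual μ)) ∧
        (∀ a : A, (Φ (hI.canonicalMap a) : H →L[ℂ] H) = π a)) ∧
    -- (d) the identification of the von Neumann algebra with the dual
      (∃ Ψ : VN ≃ₗᵢ[ℂ] StrongDual ℂ (FourierSpaceOf π),
        (∀ (T : VN) (ξ η : ℕ → H) (φ : FourierSpaceOf π),
          (Summable fun n => ‖ξ n‖ * ‖η n‖) →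
          (∀ a : A, HasSum (fun n => coeff π (ξ n) (η n) a) (fourierIncl π φ a)) →
          HasSum (fun n => inner ℂ (η n) ((T : H →L[ℂ] H) (ξ n))) (Ψ T φ)) ∧
        (∀ S T, Ψ (S * T) = hI.arensMul (Ψ S) (Ψ T)) ∧
        (∀ T, Ψ (star T) = inv (Ψ T)) ∧
        @IsHomeomorph VN (WeakDual ℂ (FourierSpaceOf π))
          (TopologicalSpace.induced Subtype.val (ultraweak H)) inferInstance
          (fun T => StrongDual.toWeakDual (Ψ T))) := by
  have hI := isLeftIntroverted_fourierIncl π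
  refine ⟨fun ξ η hs => ?_, fun φ => ?_, isGLB_norm, hI, fourierStar, fourierIncl_fourierStar,
    starFunctional_coeff, norm_starFunctional, norm_fourierStar, dualStar, dualStar_apply,
    isWStarAlgebra_dual π hI, vonNeumann π, coe_vonNeumann π, isLeast_vonNeumann π,
    ⟨dualEquiv π, fun μ ξ η => inner_dualOp μ ξ η, fun μ ν => Subtype.ext (dualOp_arensMul hI μ ν),
      fun μ => Subtype.ext (dualOp_dualStar μ), ?_, dualOp_canonicalMap _⟩,
    ⟨(dualEquiv π).symm, fun T ξ η φ hs h => ?_, fun S T => ?_, fun T => ?_, ?_⟩⟩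
  · have h := (summable_coeffIn π hs).hasSum
    exact ⟨_, fun a => (hasSum_fourierIncl_apply h a).tendsto_sum_nat, h⟩
  · obtain ⟨ξ, η, hs, h, -⟩ := exists_hasSum_coeffIn φ one_pos
    exact ⟨ξ, η, hs, h⟩
  · exact @isHomeomorph_of_eq_induced _ _ _ _ (ultraweak H)
      (WeakDual.toStrongDual.toEquiv.trans (dualEquiv π).toEquiv) Subtype.val
      (weakDual_topology_eq π)
  · obtain ⟨μ, rfl⟩ := (dualEquiv π).surjective T
    rw [LinearIsometryEquiv.symm_apply_apply]
    exact hasSum_inner_dualOp μ (hasSum_coeffIn_of_pointwise hs h)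
  · obtain ⟨μ, rfl⟩ := (dualEquiv π).surjective S
    obtain ⟨ν, rfl⟩ := (dualEquiv π).surjective T
    rw [LinearIsometryEquiv.symm_apply_apply, LinearIsometryEquiv.symm_apply_apply,
      LinearIsometryEquiv.symm_apply_eq]
    exact Subtype.ext (dualOp_arensMul hI μ ν).symm
  · obtain ⟨μ, rfl⟩ := (dualEquiv π).surjective T
    rw [LinearIsometryEquiv.symm_apply_apply, LinearIsometryEquiv.symm_apply_eq]
    exact Subtype.ext (dualOp_dualStar μ).symm
  · exact @isHomeomorph_symm_of_eq_induced _ _ _ _ (ultraweak H)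
      (WeakDual.toStrongDual.toEquiv.trans (dualEquiv π).toEquiv) Subtype.val
      (weakDual_topology_eq π)
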